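/- Let $\mathbb H,\mathbb U$ be (real or complex) Hilbert spaces, let $(S(t))_{t\in\mathbb R}$ be a strongly continuous group of bounded operators on $\mathbb H$ with infinitesimal generator $A$, and write $e^{tA^*}=S(t)^*$. Equip $\mathcal D(A^*)$ with the scalar product $\langle z_1,z_2\rangle_{\mathbb H}+\langle A^*z_1,A^*z_2\rangle_{\mathbb H}$, let $\mathcal D(A^*)'$ be its dual with respect to the pivot space $\mathbb H$, let $B\in\mathcal L(\mathbb U,\mathcal D(A^*)')$, and let $B^*\in\mathcal L(\mathcal D(A^*),\mathbb U)$ be its adjoint, $\langle Bu,z\rangle=\langle u,B^*z\rangle_{\mathbb U}$. Assume that $B$ is admissible: for all $T'>0$ and $u\in L^2((0,T');\mathbb U)$ the function $t\mapsto\int_0^tS(t-s)Bu(s)\,ds$ (integral in $\mathcal D(A^*)'$, tested against $\mathcal D(A^*)$) belongs to $C([0,T'];\mathbb H)$. Assume that the system $y'=Ay+Bu$ is exactly controllable in some time $T>0$: for all $y_0,y_T\in\mathbb H$ there is $u\in L^2((0,T);\mathbb U)$ such that the weak solution $y\in C([0,T];\mathbb H)$ with $y(0)=y_0$ satisfies $y(T)=y_T$.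 Here $y$ is a weak solution if $\frac{d}{dt}\langle y,\varphi\rangle=\langle y,A^*\varphi\rangle+\langle u,B^*\varphi\rangle$ in the sense of distributions on $(0,T)$ for every $\varphi\in\mathcal D(A^*)$. Let $W\in\mathcal L(\mathbb U)$ be symmetric and non-negative, and let $\lambda\in\mathbb R$ satisfy $\lambda>\omega_0(-A^*):=\inf_{t>0}\frac1t\log\|e^{-tA^*}\|_{\mathcal L(\mathbb H)}$ (with $\log 0=-\infty$). Then the map $z\mapsto B^*e^{-sA^*}z$ from $\mathcal D(A^*)$ to $L^2_{\rm loc}([0,\infty);\mathbb U)$ extends by continuity to $z\in\mathbb H$, and there is a unique map $Q:\mathbb H\to\mathbb H$ with $$\langle Qz_1,z_2\rangle=\int_0^\infty e^{-2\lambda s}\langle WB^*e^{-sA^*}z_1,B^*e^{-sA^*}z_2\rangle\,ds\qquad\text{for all }z_1,z_2\in\mathbb H,$$ the integral being absolutely convergent. This $Q$ is linear, bounded and symmetric, and it satisfies $AQ+QA^*-BWB^*+2\lambda Q=0$, that is, $$\langle Qx,A^*y\rangle_{\mathbb H}+\langle A^*x,Qy\rangle_{\mathbb H}-\langle WB^*x,B^*y\rangle_{\mathbb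 U}+2\lambda\langle Qx,y\rangle_{\mathbb H}=0\qquad\text{for all }x,y\in\mathcal D(A^*).$$ If moreover $W$ is positive, i.e. $\langle Wu,u\rangle\ge c\|u\|^2$ for some $c>0$ and all $u\in\mathbb U$, then $Q$ is invertible in $\mathcal L(\mathbb H)$. -/

import Mathlib

open MeasureTheory Filter Topology
open scoped LinearPMap ContDiff ENNReal

noncomputable section

namespace ControlGramian

variable {𝕜 H U : Type*} [RCLike 𝕜]
  [NormedAddCommGroup H] [InnerProductSpace 𝕜 H] [CompleteSpace H]
  [NormedAddCommGroup U] [InnerProductSpace 𝕜 U] [CompleteSpace U]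

/-- A strongly continuous group `(S(t))_{t ∈ ℝ}` of bounded operators on `H`. -/
structure StronglyContinuousGroup (𝕜 H : Type*) [RCLike 𝕜] [NormedAddCommGroup H]
    [InnerProductSpace 𝕜 H] where
  op : ℝ → H →L[𝕜] H
  op_zero : op 0 = ContinuousLinearMap.id 𝕜 H
  op_add : ∀ s t : ℝ, op (s + t) = (op s).comp (op t)
  tendsto_op : ∀ x : H, Tendsto (fun t : ℝ => op t x) (𝓝 0) (𝓝 x)

namespace StronglyContinuousGroup

section Generator

variable {𝕜 H : Type*} [RCLike 𝕜] [NormedAddCommGroup H] [InnerProductSpace 𝕜 H]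

/-- `y = lim_{t → 0} (S(t) x - x) / t`. -/
def HasGenerator (S : StronglyContinuousGroup 𝕜 H) (x y : H) : Prop :=
  Tendsto (fun t : ℝ => ((t⁻¹ : ℝ) : 𝕜) • (S.op t x - x)) (𝓝[≠] 0) (𝓝 y)

theorem HasGenerator.unique {S : StronglyContinuousGroup 𝕜 H} {x y y' : H}
    (h : S.HasGenerator x y) (h' : S.HasGenerator x y') : y = y' :=
  tendsto_nhds_unique h h'

theorem HasGenerator.add {S : StronglyContinuousGroup 𝕜 H} {x y x' y' : H}
    (h : S.HasGenerator x y) (h' : S.HasGenerator x' y') :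
    S.HasGenerator (x + x') (y + y') := by
  refine (Tendsto.add h h').congr fun t => ?_
  rw [← smul_add, map_add, add_sub_add_comm]

theorem HasGenerator.smul {S : StronglyContinuousGroup 𝕜 H} {x y : H} (c : 𝕜)
    (h : S.HasGenerator x y) : S.HasGenerator (c • x) (c • y) := by
  refine (Tendsto.const_smul h c).congr fun t => ?_
  rw [map_smul, ← smul_sub, smul_comm]

theorem HasGenerator.op {S : StronglyContinuousGroup 𝕜 H} {x y : H} (t : ℝ)
    (h : S.HasGenerator x y) : S.HasGenerator (S.op t x) (S.op t y) := by
  refine (((S.op t).continuous.tendsto y).comp h).congr fun r => ?_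
  have e1 := congrArg (fun L : H →L[𝕜] H => L x) (S.op_add r t)
  have e2 := congrArg (fun L : H →L[𝕜] H => L x) (S.op_add t r)
  simp only [ContinuousLinearMap.comp_apply] at e1 e2
  simp only [Function.comp_apply, map_smul, map_sub]
  rw [← e1, ← e2, add_comm]

/-- The infinitesimal generator `A` of the group: `𝓓(A)` is the set of `x` for which
`A x = lim_{t → 0} (S(t) x - x) / t` exists. -/
def generator (S : StronglyContinuousGroup 𝕜 H) : H →ₗ.[𝕜] H where
  domain :=
    { carrier := {x | ∃ y : H, S.HasGenerator x y}
      zero_mem' := ⟨0, by simp [HasGenerator]⟩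
      add_mem' := fun ⟨y, hy⟩ ⟨y', hy'⟩ => ⟨y + y', hy.add hy'⟩
      smul_mem' := fun c _ ⟨y, hy⟩ => ⟨c • y, hy.smul c⟩ }
  toFun :=
    { toFun := fun x => Classical.choose x.2
      map_add' := fun x x' =>
        (Classical.choose_spec (x + x').2).unique
          ((Classical.choose_spec x.2).add (Classical.choose_spec x'.2))
      map_smul' := fun c x =>
        (Classical.choose_spec (c • x).2).unique ((Classical.choose_spec x.2).smul c) }

theorem hasGenerator_generator (S : StronglyContinuousGroup 𝕜 H) (x : S.generator.domain) :
    S.HasGenerator (x : H) (S.generator x) :=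
  Classical.choose_spec x.2

end Generator

/-- The adjoint group `e^{t A^*} = S(t)^*`; in particular `e^{-s A^*} = S(-s)^*`. -/
def adj (S : StronglyContinuousGroup 𝕜 H) (t : ℝ) : H →L[𝕜] H :=
  ContinuousLinearMap.adjoint (S.op t)

/-- `𝓓(A^*)` is invariant under the adjoint group. -/
theorem adj_mem (S : StronglyContinuousGroup 𝕜 H) (t : ℝ) (φ : (S.generator†).domain) :
    S.adj t (φ : H) ∈ (S.generator†).domain := by
  have hφ := (LinearPMap.mem_adjoint_domain_iff (T := S.generator) (φ : H)).1 φ.2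
  rw [LinearPMap.mem_adjoint_domain_iff]
  have hmem : ∀ x : S.generator.domain, S.op t (x : H) ∈ S.generator.domain := fun x =>
    ⟨_, (S.hasGenerator_generator x).op t⟩
  have hcont : Continuous fun x : S.generator.domain =>
      (⟨S.op t (x : H), hmem x⟩ : S.generator.domain) :=
    ((S.op t).continuous.comp continuous_subtype_val).subtype_mk _
  refine (hφ.comp hcont).congr fun x => ?_
  have hval : S.generator ⟨S.op t (x : H), hmem x⟩ = S.op t (S.generator x) :=
    (S.hasGenerator_generator ⟨S.op t (x : H), hmem x⟩).unique
      ((S.hasGenerator_generator x).op t)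
  change inner 𝕜 (φ : H) (S.generator ⟨S.op t (x : H), hmem x⟩) =
    inner 𝕜 (ContinuousLinearMap.adjoint (S.op t) (φ : H)) (S.generator x)
  rw [hval, ContinuousLinearMap.adjoint_inner_left]

/-- The restriction of `e^{t A^*}` to `𝓓(A^*)`. -/
def adjDom (S : StronglyContinuousGroup 𝕜 H) (t : ℝ) (φ : (S.generator†).domain) :
    (S.generator†).domain :=
  ⟨S.adj t (φ : H), S.adj_mem t φ⟩

end StronglyContinuousGroup

/-- `𝓓(A^*)` with the scalar product `⟪z₁, z₂⟫ + ⟪A^* z₁, A^* z₂⟫`, realised as the graph of `A^*`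
in the Hilbert space `H × H`. -/
abbrev AdjointGraph (A : H →ₗ.[𝕜] H) : Submodule 𝕜 (WithLp 2 (H × H)) :=
  (A†).graph.comap (WithLp.linearEquiv 2 𝕜 (H × H)).toLinearMap

/-- The identification of `z ∈ 𝓓(A^*)` with the point `(z, A^* z)` of the graph. -/
def toGraph (A : H →ₗ.[𝕜] H) (z : (A†).domain) : AdjointGraph A :=
  ⟨WithLp.toLp 2 ((z : H), A† z), (A†).mem_graph z⟩

theorem inner_toGraph (A : H →ₗ.[𝕜] H) (z₁ z₂ : (A†).domain) :
    inner 𝕜 (toGraph A z₁) (toGraph A z₂) =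
      inner 𝕜 (z₁ : H) (z₂ : H) + inner 𝕜 (A† z₁) (A† z₂) :=
  rfl

theorem toGraph_surjective (A : H →ₗ.[𝕜] H) : Function.Surjective (toGraph A) := by
  rintro ⟨p, hp⟩
  obtain ⟨z, hz⟩ := ((A†).mem_graph_iff).1 hp
  refine ⟨z, Subtype.ext ?_⟩
  refine (WithLp.linearEquiv 2 𝕜 (H × H)).injective ?_
  exact Prod.ext hz.1 hz.2

/-- The space `𝓓(A^*)'` of bounded functionals on `𝓓(A^*)`. The functional attached to `f` is
`φ ↦ ⟨f, φ⟩`, with a scalar product that is linear in its first entry, hence it is conjugate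
linear in `φ`. (For real scalars it is just linear.) -/
abbrev DualDomain (A : H →ₗ.[𝕜] H) : Type _ := AdjointGraph A →L⋆[𝕜] 𝕜

/-- The adjoint `B^* : 𝓓(A^*) → U` of `B ∈ 𝓛(U, 𝓓(A^*)')`, on the graph space. -/
def controlAdjointGraph {A : H →ₗ.[𝕜] H} (B : U →L[𝕜] DualDomain A) :
    AdjointGraph A →L[𝕜] U :=
  ((InnerProductSpace.toDual 𝕜 U).symm.toContinuousLinearEquiv.toContinuousLinearMap).comp B.flip

/-- `B^* z` for `z ∈ 𝓓(A^*)`. -/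
def controlAdjoint {A : H →ₗ.[𝕜] H} (B : U →L[𝕜] DualDomain A) (z : (A†).domain) : U :=
  controlAdjointGraph B (toGraph A z)

/-- The defining property `⟨B u, z⟩ = ⟨u, B^* z⟩` of `B^*`. -/
theorem inner_controlAdjoint {A : H →ₗ.[𝕜] H} (B : U →L[𝕜] DualDomain A) (z : (A†).domain)
    (u : U) : inner 𝕜 (controlAdjoint B z) u = B u (toGraph A z) := by
  simp [controlAdjoint, controlAdjointGraph]

/-- `B` is an admissible control operator: for all `T > 0` and `u ∈ L²(0, T; U)`, the function
`t ↦ ∫₀ᵗ S(t - s) B u(s) ds`, an element of `𝓓(A^*)'` for each `t`, belongs to `C([0, T]; H)`. -/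
def IsAdmissible (S : StronglyContinuousGroup 𝕜 H) (B : U →L[𝕜] DualDomain S.generator) : Prop :=
  ∀ T : ℝ, 0 < T → ∀ u : ℝ → U, MemLp u 2 (volume.restrict (Set.Ioo 0 T)) →
    ∃ y : ℝ → H, ContinuousOn y (Set.Icc 0 T) ∧
      ∀ t ∈ Set.Icc 0 T, ∀ φ : (S.generator†).domain,
        inner 𝕜 (y t) (φ : H) =
          ∫ s in Set.Ioo 0 t, inner 𝕜 (u s) (controlAdjoint B (S.adjDom (t - s) φ))

/-- `y` is a weak solution on `[0, T]` of `y' = A y + B u`, `y(0) = y₀`: it is continuous, and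
`d/dt ⟨y, φ⟩ = ⟨y, A^* φ⟩ + ⟨u, B^* φ⟩` in the sense of distributions on `(0, T)`, for all
`φ ∈ 𝓓(A^*)`. -/
structure IsWeakSolution (A : H →ₗ.[𝕜] H) (B : U →L[𝕜] DualDomain A) (T : ℝ) (y₀ : H)
    (u : ℝ → U) (y : ℝ → H) : Prop where
  continuousOn : ContinuousOn y (Set.Icc 0 T)
  initial : y 0 = y₀
  weak : ∀ φ : (A†).domain, ∀ η : ℝ → ℝ, ContDiff ℝ ∞ η → HasCompactSupport η →
    tsupport η ⊆ Set.Ioo 0 T →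
      -∫ t in Set.Ioo 0 T, ((deriv η t : ℝ) : 𝕜) * inner 𝕜 (y t) (φ : H) =
        ∫ t in Set.Ioo 0 T, ((η t : ℝ) : 𝕜) *
          (inner 𝕜 (y t) (A† φ) + inner 𝕜 (u t) (controlAdjoint B φ))

/-- Exact controllability of `y' = A y + B u` in time `T`. -/
def ExactlyControllable (A : H →ₗ.[𝕜] H) (B : U →L[𝕜] DualDomain A) (T : ℝ) : Prop :=
  ∀ y₀ y₁ : H, ∃ u : ℝ → U, MemLp u 2 (volume.restrict (Set.Ioo 0 T)) ∧
    ∃ y : ℝ → H, IsWeakSolution A B T y₀ u y ∧ y T = y₁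

/-- The growth bound `inf_{t > 0} t⁻¹ log ‖E(t)‖` of a family of operators, with `log 0 = -∞`. -/
def growthBound (E : ℝ → H →L[𝕜] H) : EReal :=
  ⨅ (t : ℝ) (_ : 0 < t), ENNReal.log ‖E t‖ₑ / (t : EReal)

/-- `w` is (a representative of) the function `s ↦ B^* e^{-s A^*} z` on `(0, ∞)`, for `z ∈ H`:
the value at `z` of the extension by continuity, from `𝓓(A^*)` to `H`, of the map
`φ ↦ B^* e^{-· A^*} φ` with values in `L²_loc([0, ∞); U)`. -/
def IsOutput (S : StronglyContinuousGroup 𝕜 H) (B : U →L[𝕜] DualDomain S.generator) (z : H)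
    (w : ℝ → U) : Prop :=
  ∀ T : ℝ, 0 < T →
    MemLp w 2 (volume.restrict (Set.Ioo 0 T)) ∧
    Tendsto
      (fun φ : (S.generator†).domain =>
        eLpNorm (fun s : ℝ => controlAdjoint B (S.adjDom (-s) φ) - w s) 2
          (volume.restrict (Set.Ioo 0 T)))
      (comap (Subtype.val : (S.generator†).domain → H) (𝓝 z)) (𝓝 0)

/-- `Q : H → H` satisfies
`⟨Q z₁, z₂⟩ = ∫₀^∞ e^{-2 λ s} ⟨W B^* e^{-s A^*} z₁, B^* e^{-s A^*} z₂⟩ ds` for all `z₁, z₂ ∈ H`,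
with an absolutely convergent integral. -/
def IsGramian (S : StronglyContinuousGroup 𝕜 H) (B : U →L[𝕜] DualDomain S.generator)
    (W : U →L[𝕜] U) (lam : ℝ) (Q : H → H) : Prop :=
  ∀ (z₁ z₂ : H) (w₁ w₂ : ℝ → U), IsOutput S B z₁ w₁ → IsOutput S B z₂ w₂ →
    IntegrableOn (fun s : ℝ => ((Real.exp (-2 * lam * s) : ℝ) : 𝕜) * inner 𝕜 (W (w₁ s)) (w₂ s))
      (Set.Ioi 0) ∧
    inner 𝕜 (Q z₁) z₂ =
      ∫ s in Set.Ioi (0 : ℝ), ((Real.exp (-2 * lam * s) : ℝ) : 𝕜) * inner 𝕜 (W (w₁ s)) (w₂ s)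

/-- The operator identity `A Q + Q A^* - B W B^* + Q R Q + 2 λ Q = 0`, tested on `𝓓(A^*)`. -/
def OperatorIdentity (A : H →ₗ.[𝕜] H) (B : U →L[𝕜] DualDomain A) (Q R : H →L[𝕜] H)
    (W : U →L[𝕜] U) (lam : ℝ) : Prop :=
  ∀ x y : (A†).domain,
    inner 𝕜 (Q (x : H)) (A† y) + inner 𝕜 (A† x) (Q (y : H))
      - inner 𝕜 (W (controlAdjoint B x)) (controlAdjoint B y)
      + inner 𝕜 (R (Q (x : H))) (Q (y : H))
      + 2 * (lam : 𝕜) * inner 𝕜 (Q (x : H)) (y : H) = 0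

/-- A symmetric operator is positive if it is coercive. -/
def IsCoercive (W : U →L[𝕜] U) : Prop :=
  ∃ c : ℝ, 0 < c ∧ ∀ u : U, c * ‖u‖ ^ 2 ≤ RCLike.re (inner 𝕜 (W u) u)

end ControlGramian

end

/-! For `φ ∈ 𝓓(A^*)` put `(Ψ φ)(s) = e^{-λ s} B^* e^{-s A^*} φ`. Everything follows once `Ψ` extends
to a bounded operator `H → L²(0, ∞; U)`, for then `Q = Ψ^* W Ψ` (`gramian`) has the required
integral representation.

Boundedness: pairing `s ↦ B^* e^{(T-s) A^*} φ` with a control `u` gives `⟨y(T), φ⟩`, which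
admissibility bounds by a multiple of `‖φ‖` for each `u`; uniform boundedness makes this an `L²`
estimate on a finite interval (`IsAdmissible.exists_observation_le`). Since `λ` exceeds the growth
bound, some `t > 0` has `e^{-λ t} ‖e^{-t A^*}‖ < 1`, and the estimates on successive blocks of
length `t` sum like a geometric series (`IsAdmissible.exists_integral_weightedOutput_le`).

Operator identity: moving the states along `e^{-h A^*}` shifts time, so `e^{-2 λ h} ⟨Q e^{-h A^*} x,
e^{-h A^*} y⟩` is the tail from `h` to `∞` of the Gramian integral; differentiating at `h = 0` gives
the identity (`operatorIdentity_gramian`).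

Invertibility: weak solutions obey the variation of constants formula
(`IsWeakSolution.inner_eq_integral`), so exact controllability gives, again by uniform boundedness,
the observability inequality `‖z‖² ≤ C ‖Ψ z‖²`. With `W` coercive, `Q` is then coercive, hence
invertible (`isUnit_gramian`). -/

noncomputable section

namespace ControlGramian

namespace StronglyContinuousGroup

/-! ### Strongly continuous groups and their time integrals. -/

section Basic

variable {𝕜 H : Type*} [RCLike 𝕜] [NormedAddCommGroup H] [InnerProductSpace 𝕜 H]

theorem op_add_apply (S : StronglyContinuousGroup 𝕜 H) (s t : ℝ) (x : H) :
    S.op (s + t) x = S.op s (S.op t x) := by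
  rw [S.op_add]; rfl

theorem op_zero_apply (S : StronglyContinuousGroup 𝕜 H) (x : H) : S.op 0 x = x := by
  rw [S.op_zero]; rfl

theorem continuous_op_apply (S : StronglyContinuousGroup 𝕜 H) (x : H) :
    Continuous fun t => S.op t x := by
  rw [continuous_iff_continuousAt]
  intro t
  have h1 : Tendsto (fun r : ℝ => r - t) (𝓝 t) (𝓝 0) := by
    have : Continuous fun r : ℝ => r - t := by fun_prop
    simpa using this.tendsto t
  have h2 := ((S.op t).continuous.tendsto x).comp ((S.tendsto_op x).comp h1)
  refine h2.congr fun r => ?_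
  simp only [Function.comp_apply]
  rw [← S.op_add_apply, add_sub_cancel]

theorem exists_norm_op_le [CompleteSpace H] (S : StronglyContinuousGroup 𝕜 H) {K : Set ℝ}
    (hK : IsCompact K) : ∃ M : ℝ, 0 ≤ M ∧ ∀ t ∈ K, ‖S.op t‖ ≤ M := by
  have h : ∀ x, ∃ C, ∀ i : K, ‖S.op i x‖ ≤ C := by
    intro x
    obtain ⟨C, hC⟩ := (hK.image (S.continuous_op_apply x)).isBounded.exists_norm_le
    exact ⟨C, fun i => hC _ ⟨i, i.2, rfl⟩⟩
  obtain ⟨C, hC⟩ := banach_steinhaus h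
  exact ⟨max C 0, le_max_right _ _, fun t ht => (hC ⟨t, ht⟩).trans (le_max_left _ _)⟩

/-- Derivatives and integrals in time need a real structure on `H`; the one restricted from `𝕜` is
introduced locally inside proofs. -/
theorem isScalarTower_restrictScalars :
    letI := NormedSpace.restrictScalars ℝ 𝕜 H
    IsScalarTower ℝ 𝕜 H := by
  let := NormedSpace.restrictScalars ℝ 𝕜 H
  refine ⟨fun r c x => ?_⟩
  change (r • c) • x = (algebraMap ℝ 𝕜 r) • (c • x)
  rw [Algebra.smul_def, mul_smul]

variable [NormedSpace ℝ H] [IsScalarTower ℝ 𝕜 H]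

theorem hasGenerator_iff_hasDerivAt (S : StronglyContinuousGroup 𝕜 H) (x y : H) :
    S.HasGenerator x y ↔ HasDerivAt (fun t => S.op t x) y 0 := by
  rw [hasDerivAt_iff_tendsto_slope_zero]
  refine tendsto_congr fun t => ?_
  rw [zero_add, S.op_zero_apply, RCLike.real_smul_eq_coe_smul (K := 𝕜)]

theorem HasGenerator.hasDerivAt {S : StronglyContinuousGroup 𝕜 H} {x y : H}
    (h : S.HasGenerator x y) (t : ℝ) : HasDerivAt (fun t => S.op t x) (S.op t y) t := by
  have h1 := (S.hasGenerator_iff_hasDerivAt _ _).1 (h.op t)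
  have h2 : HasDerivAt (fun r : ℝ => r - t) 1 t := (hasDerivAt_id t).sub_const t
  have h3 : HasDerivAt (fun r => S.op r (S.op t x)) (S.op t y) (t - t) := by simpa using h1
  have h4 := HasDerivAt.scomp (h := fun r : ℝ => r - t) t h3 h2
  rw [one_smul] at h4
  convert h4 using 1
  funext r
  simp only [Function.comp_apply]
  rw [← S.op_add_apply, sub_add_cancel]

/-- The operator `x ↦ ∫₀ʰ S(s) x ds`. -/
def timeIntegral [CompleteSpace H] (S : StronglyContinuousGroup 𝕜 H) (h : ℝ) : H →L[𝕜] H :=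
  LinearMap.mkContinuousOfExistsBound
    { toFun := fun x => ∫ s in (0 : ℝ)..h, S.op s x
      map_add' := fun x y => by
        simp only [map_add]
        exact intervalIntegral.integral_add ((S.continuous_op_apply x).intervalIntegrable _ _)
          ((S.continuous_op_apply y).intervalIntegrable _ _)
      map_smul' := fun c x => by
        simp only [map_smul, RingHom.id_apply]
        exact intervalIntegral.integral_smul c _ } (by
    obtain ⟨M, -, hM⟩ := S.exists_norm_op_le (isCompact_uIcc (a := 0) (b := h))
    refine ⟨M * |h - 0|, fun x => ?_⟩
    refine (intervalIntegral.norm_integral_le_of_norm_le_const (C := M * ‖x‖) fun s hs => ?_).trans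
      (le_of_eq (by ring))
    exact (S.op s).le_of_opNorm_le (hM s (Set.uIoc_subset_uIcc hs)) x)

variable [CompleteSpace H]

theorem timeIntegral_apply (S : StronglyContinuousGroup 𝕜 H) (h : ℝ) (x : H) :
    S.timeIntegral h x = ∫ s in (0 : ℝ)..h, S.op s x := rfl

theorem hasDerivAt_timeIntegral (S : StronglyContinuousGroup 𝕜 H) (h : ℝ) (x : H) :
    HasDerivAt (fun h => S.timeIntegral h x) (S.op h x) h :=
  intervalIntegral.integral_hasDerivAt_right ((S.continuous_op_apply x).intervalIntegrable _ _)
    (S.continuous_op_apply x).stronglyMeasurable.stronglyMeasurableAtFilter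
    (S.continuous_op_apply x).continuousAt

theorem timeIntegral_zero (S : StronglyContinuousGroup 𝕜 H) : S.timeIntegral 0 = 0 := by
  ext x; simp [timeIntegral_apply]

theorem exists_norm_timeIntegral_le (S : StronglyContinuousGroup 𝕜 H) :
    ∃ M : ℝ, 0 ≤ M ∧ ∀ h ∈ Set.Icc (-1 : ℝ) 1, ‖S.timeIntegral h‖ ≤ M * |h| := by
  obtain ⟨M, hM0, hM⟩ := S.exists_norm_op_le (isCompact_Icc (a := (-1 : ℝ)) (b := 1))
  refine ⟨M, hM0, fun h hh => ContinuousLinearMap.opNorm_le_bound _ (by positivity) fun x => ?_⟩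
  refine (intervalIntegral.norm_integral_le_of_norm_le_const (C := M * ‖x‖) fun s hs => ?_).trans
      (le_of_eq (by rw [sub_zero]; ring))
  refine (S.op s).le_of_opNorm_le (hM s ?_) x
  exact (Set.uIcc_subset_Icc (by simp) hh) (Set.uIoc_subset_uIcc hs)

/-- The group law turns `S(t)` into a translation of the integration interval, so orbits of time
integrals are differences of primitives and therefore differentiable. -/
theorem op_timeIntegral (S : StronglyContinuousGroup 𝕜 H) (t h : ℝ) (x : H) :
    S.op t (S.timeIntegral h x) = S.timeIntegral (t + h) x - S.timeIntegral t x := by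
  have hc := S.continuous_op_apply x
  rw [timeIntegral_apply, timeIntegral_apply, timeIntegral_apply,
    intervalIntegral.integral_interval_sub_left (hc.intervalIntegrable _ _)
      (hc.intervalIntegrable _ _),
    ← ContinuousLinearMap.intervalIntegral_comp_comm _ (hc.intervalIntegrable _ _)]
  simp only [← S.op_add_apply]
  rw [intervalIntegral.integral_comp_add_left (fun s => S.op s x), add_zero]

theorem hasGenerator_timeIntegral (S : StronglyContinuousGroup 𝕜 H) (h : ℝ) (x : H) :
    S.HasGenerator (S.timeIntegral h x) (S.op h x - x) := by
  rw [hasGenerator_iff_hasDerivAt]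
  simp only [op_timeIntegral]
  have h1 : HasDerivAt (fun h => S.timeIntegral h x) (S.op h x) (0 + h) := by
    simpa using S.hasDerivAt_timeIntegral h x
  have h2 := h1.comp_add_const 0 h
  have h3 := S.hasDerivAt_timeIntegral 0 x
  rw [S.op_zero_apply] at h3
  exact h2.sub h3

theorem HasGenerator.timeIntegral_eq {S : StronglyContinuousGroup 𝕜 H} {x y : H}
    (hxy : S.HasGenerator x y) (h : ℝ) : S.timeIntegral h y = S.op h x - x := by
  rw [timeIntegral_apply, intervalIntegral.integral_eq_sub_of_hasDerivAt
    (fun t _ => hxy.hasDerivAt t) ((S.continuous_op_apply y).intervalIntegrable _ _),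
    S.op_zero_apply]

theorem tendsto_inv_smul_timeIntegral (S : StronglyContinuousGroup 𝕜 H) (x : H) :
    Tendsto (fun h : ℝ => h⁻¹ • S.timeIntegral h x) (𝓝[≠] 0) (𝓝 x) := by
  have h3 := S.hasDerivAt_timeIntegral 0 x
  rw [S.op_zero_apply, hasDerivAt_iff_tendsto_slope_zero] at h3
  simpa [timeIntegral_zero] using h3

end Basic

/-! ### The adjoint group and the domain of `A^*`. -/

section Adjoint

variable {𝕜 H : Type*} [RCLike 𝕜] [NormedAddCommGroup H] [InnerProductSpace 𝕜 H] [CompleteSpace H]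

theorem dense_generator_domain (S : StronglyContinuousGroup 𝕜 H) :
    Dense (S.generator.domain : Set H) := by
  let := NormedSpace.restrictScalars ℝ 𝕜 H
  have : IsScalarTower ℝ 𝕜 H := isScalarTower_restrictScalars
  intro x
  refine mem_closure_of_tendsto (S.tendsto_inv_smul_timeIntegral x) (Eventually.of_forall fun h => ?_)
  rw [RCLike.real_smul_eq_coe_smul (K := 𝕜)]
  exact S.generator.domain.smul_mem _ ⟨_, S.hasGenerator_timeIntegral h x⟩

theorem HasGenerator.inner_adjoint {S : StronglyContinuousGroup 𝕜 H} {x y : H}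
    (h : S.HasGenerator x y) (φ : (S.generator†).domain) :
    inner 𝕜 (S.generator† φ) x = inner 𝕜 (φ : H) y := by
  have h1 := S.generator.adjoint_isFormalAdjoint S.dense_generator_domain φ ⟨x, y, h⟩
  rwa [(S.hasGenerator_generator ⟨x, y, h⟩).unique h] at h1

/-- Dual to `hasGenerator_timeIntegral`. Taking the adjoint of the integrated operator avoids
integrating `S(s)^*`, whose strong continuity is not yet available. -/
theorem adj_sub_self [NormedSpace ℝ H] [IsScalarTower ℝ 𝕜 H] (S : StronglyContinuousGroup 𝕜 H)
    (t : ℝ) (φ : (S.generator†).domain) :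
    S.adj t φ - φ = ContinuousLinearMap.adjoint (S.timeIntegral t) (S.generator† φ) := by
  refine ext_inner_right 𝕜 fun x => ?_
  rw [ContinuousLinearMap.adjoint_inner_left,
    (S.hasGenerator_timeIntegral t x).inner_adjoint, inner_sub_left, inner_sub_right, adj,
    ContinuousLinearMap.adjoint_inner_left]

/-- The adjoint of `∫₀ʰ S(s) ds` maps `H` into `𝓓(A^*)`. A vector `x` orthogonal to `𝓓(A^*)` thus
satisfies `∫₀ʰ S(s) x ds = 0` for every `h`; dividing by `h` and letting `h → 0` gives `x = 0`. -/
theorem dense_adjoint_domain (S : StronglyContinuousGroup 𝕜 H) :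
    Dense ((S.generator†).domain : Set H) := by
  let := NormedSpace.restrictScalars ℝ 𝕜 H
  have : IsScalarTower ℝ 𝕜 H := isScalarTower_restrictScalars
  rw [Submodule.dense_iff_topologicalClosure_eq_top, Submodule.topologicalClosure_eq_top_iff,
    Submodule.eq_bot_iff]
  intro x hx
  have h0 : ∀ h, S.timeIntegral h x = 0 := by
    intro h
    refine ext_inner_left 𝕜 fun z => ?_
    have hz : ContinuousLinearMap.adjoint (S.timeIntegral h) z ∈ (S.generator†).domain := by
      refine LinearPMap.mem_adjoint_domain_of_exists _ ⟨S.adj h z - z, fun w => ?_⟩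
      rw [ContinuousLinearMap.adjoint_inner_left,
        (S.hasGenerator_generator w).timeIntegral_eq, inner_sub_left, inner_sub_right, adj,
        ContinuousLinearMap.adjoint_inner_left]
    rw [inner_zero_right, ← ContinuousLinearMap.adjoint_inner_left]
    exact (Submodule.mem_orthogonal _ _).1 hx _ hz
  have h1 := S.tendsto_inv_smul_timeIntegral x
  simp only [h0, smul_zero] at h1
  exact tendsto_nhds_unique h1 tendsto_const_nhds

theorem norm_adj (S : StronglyContinuousGroup 𝕜 H) (t : ℝ) : ‖S.adj t‖ = ‖S.op t‖ :=
  LinearIsometryEquiv.norm_map _ _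

/-- On `𝓓(A^*)`, `adj_sub_self` gives a rate `O(|t|)`; density and the uniform bound on `‖S(t)^*‖`
near `0` carry the convergence to all of `H`. -/
theorem tendsto_adj (S : StronglyContinuousGroup 𝕜 H) (z : H) :
    Tendsto (fun t => S.adj t z) (𝓝 0) (𝓝 z) := by
  let := NormedSpace.restrictScalars ℝ 𝕜 H
  have : IsScalarTower ℝ 𝕜 H := isScalarTower_restrictScalars
  obtain ⟨M, hM0, hM⟩ := S.exists_norm_op_le (isCompact_Icc (a := (-1 : ℝ)) (b := 1))
  obtain ⟨N, hN0, hN⟩ := S.exists_norm_timeIntegral_le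
  have hI : Set.Icc (-1 : ℝ) 1 ∈ 𝓝 (0 : ℝ) := Icc_mem_nhds (by norm_num) (by norm_num)
  have hdom : ∀ φ : (S.generator†).domain, Tendsto (fun t => S.adj t φ) (𝓝 0) (𝓝 (φ : H)) := by
    intro φ
    rw [tendsto_iff_norm_sub_tendsto_zero]
    have hlim : Tendsto (fun t : ℝ => N * |t| * ‖S.generator† φ‖) (𝓝 0) (𝓝 0) := by
      have : Continuous fun t : ℝ => N * |t| * ‖S.generator† φ‖ := by fun_prop
      simpa using this.tendsto 0
    refine squeeze_zero' (Eventually.of_forall fun t => norm_nonneg _) ?_ hlim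
    filter_upwards [hI] with t ht
    rw [adj_sub_self]
    refine ContinuousLinearMap.le_of_opNorm_le _ ?_ _
    rw [LinearIsometryEquiv.norm_map]
    exact hN t ht
  rw [Metric.tendsto_nhds]
  intro ε hε
  obtain ⟨φ, hφ, hd⟩ := S.dense_adjoint_domain.exists_dist_lt z
    (show 0 < ε / (2 * (M + 1)) by positivity)
  filter_upwards [hI, Metric.tendsto_nhds.1 (hdom ⟨φ, hφ⟩) (ε / 2) (by positivity)] with t ht h2
  have h1 : dist (S.adj t z) (S.adj t φ) ≤ M * dist z φ := by
    rw [dist_eq_norm, dist_eq_norm, ← map_sub]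
    refine ContinuousLinearMap.le_of_opNorm_le _ ?_ _
    rw [norm_adj]; exact hM t ht
  have h3 := dist_triangle4 (S.adj t z) (S.adj t φ) φ z
  rw [dist_comm φ z] at h3
  have h4 : (M + 1) * dist z φ < ε / 2 := by
    rw [lt_div_iff₀ (by positivity)] at hd
    linarith
  linarith

/-- The adjoint group `t ↦ S(t)^*`. -/
def adjGroup (S : StronglyContinuousGroup 𝕜 H) : StronglyContinuousGroup 𝕜 H where
  op := S.adj
  op_zero := by
    refine ContinuousLinearMap.ext fun x => ext_inner_right 𝕜 fun y => ?_
    rw [adj, ContinuousLinearMap.adjoint_inner_left, S.op_zero]; rfl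
  op_add s t := by
    rw [add_comm, adj, S.op_add, ContinuousLinearMap.adjoint_comp]; rfl
  tendsto_op := S.tendsto_adj

theorem continuous_adj_apply (S : StronglyContinuousGroup 𝕜 H) (x : H) :
    Continuous fun t => S.adj t x := S.adjGroup.continuous_op_apply x

theorem adj_add_apply (S : StronglyContinuousGroup 𝕜 H) (s t : ℝ) (x : H) :
    S.adj (s + t) x = S.adj s (S.adj t x) := S.adjGroup.op_add_apply s t x

theorem adj_zero_apply (S : StronglyContinuousGroup 𝕜 H) (x : H) : S.adj 0 x = x :=
  S.adjGroup.op_zero_apply x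

theorem adjoint_adjDom (S : StronglyContinuousGroup 𝕜 H) (t : ℝ) (φ : (S.generator†).domain) :
    S.generator† (S.adjDom t φ) = S.adj t (S.generator† φ) := by
  refine LinearPMap.adjoint_apply_eq S.dense_generator_domain _ fun x => ?_
  have h := (S.hasGenerator_generator x).op t
  rw [adj, ContinuousLinearMap.adjoint_inner_left, h.inner_adjoint]
  exact (ContinuousLinearMap.adjoint_inner_left _ _ _).symm

theorem adjDom_add (S : StronglyContinuousGroup 𝕜 H) (s t : ℝ) (φ : (S.generator†).domain) :
    S.adjDom (s + t) φ = S.adjDom s (S.adjDom t φ) := Subtype.ext (S.adj_add_apply s t φ)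

theorem adjDom_zero (S : StronglyContinuousGroup 𝕜 H) (φ : (S.generator†).domain) :
    S.adjDom 0 φ = φ := Subtype.ext (S.adj_zero_apply φ)

theorem hasDerivAt_adj [NormedSpace ℝ H] [IsScalarTower ℝ 𝕜 H] (S : StronglyContinuousGroup 𝕜 H)
    (φ : (S.generator†).domain) (t : ℝ) :
    HasDerivAt (fun t => S.adj t φ) (S.adj t (S.generator† φ)) t := by
  -- The adjoint of the time integral is the time integral of the adjoint group, seen by moving the
  -- inner product under both integrals.
  have key : ∀ t, S.adj t φ = φ + S.adjGroup.timeIntegral t (S.generator† φ) := by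
    intro t
    rw [← sub_eq_iff_eq_add', adj_sub_self]
    refine ext_inner_left 𝕜 fun x => ?_
    rw [ContinuousLinearMap.adjoint_inner_right, timeIntegral_apply, timeIntegral_apply]
    have h1 := (innerSL 𝕜 x).intervalIntegral_comp_comm
      (((S.adjGroup.continuous_op_apply (S.generator† φ)).intervalIntegrable 0 t : IntervalIntegrable _ volume 0 t))
    rw [innerSL_apply_apply] at h1
    rw [← h1, ← inner_conj_symm]
    have h2 := (innerSL 𝕜 (S.generator† φ)).intervalIntegral_comp_comm
      (((S.continuous_op_apply x).intervalIntegrable 0 t : IntervalIntegrable _ volume 0 t))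
    rw [innerSL_apply_apply] at h2
    rw [← h2, intervalIntegral.intervalIntegral_eq_integral_uIoc,
      intervalIntegral.intervalIntegral_eq_integral_uIoc, RCLike.conj_smul, ← integral_conj]
    congr 1
    refine integral_congr_ae (Eventually.of_forall fun s => ?_)
    simp only [innerSL_apply_apply, inner_conj_symm]
    exact (ContinuousLinearMap.adjoint_inner_right _ _ _).symm
  simp only [key]
  exact (S.adjGroup.hasDerivAt_timeIntegral t _).const_add _

end Adjoint

end StronglyContinuousGroup

/-! ### The operator `B^*` along the adjoint group. -/

section ControlAdjoint

variable {𝕜 H U : Type*} [RCLike 𝕜]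
  [NormedAddCommGroup H] [InnerProductSpace 𝕜 H] [CompleteSpace H]
  [NormedAddCommGroup U] [InnerProductSpace 𝕜 U] [CompleteSpace U]

theorem controlAdjoint_add {A : H →ₗ.[𝕜] H} (B : U →L[𝕜] DualDomain A) (x y : (A†).domain) :
    controlAdjoint B (x + y) = controlAdjoint B x + controlAdjoint B y := by
  rw [controlAdjoint, controlAdjoint, controlAdjoint, ← map_add]
  congr 1
  refine Subtype.ext ?_
  change WithLp.toLp 2 (((x + y : (A†).domain) : H), A† (x + y)) = _
  rw [(A†).map_add]; rfl

theorem controlAdjoint_smul {A : H →ₗ.[𝕜] H} (B : U →L[𝕜] DualDomain A) (c : 𝕜)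
    (x : (A†).domain) : controlAdjoint B (c • x) = c • controlAdjoint B x := by
  rw [controlAdjoint, controlAdjoint, ← map_smul]
  congr 1
  refine Subtype.ext ?_
  change WithLp.toLp 2 (((c • x : (A†).domain) : H), A† (c • x)) = _
  rw [(A†).map_smul]; rfl

/-- `B^*` is continuous only for the graph norm; since `A^*` commutes with the adjoint group, orbits
in `𝓓(A^*)` are continuous in that norm. -/
theorem continuous_controlAdjoint (S : StronglyContinuousGroup 𝕜 H)
    (B : U →L[𝕜] DualDomain S.generator) (φ : (S.generator†).domain) :
    Continuous fun t => controlAdjoint B (S.adjDom t φ) := by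
  refine (controlAdjointGraph B).continuous.comp ?_
  refine Continuous.subtype_mk (f := fun t =>
    WithLp.toLp 2 (((S.adjDom t φ : (S.generator†).domain) : H), S.generator† (S.adjDom t φ))) ?_ _
  simp only [S.adjoint_adjDom]
  exact (WithLp.prod_continuous_toLp 2 H H).comp
    ((S.continuous_adj_apply (φ : H)).prodMk (S.continuous_adj_apply (S.generator† φ)))

theorem adjDom_apply_add (S : StronglyContinuousGroup 𝕜 H) (t : ℝ) (x y : (S.generator†).domain) :
    S.adjDom t (x + y) = S.adjDom t x + S.adjDom t y :=
  Subtype.ext (map_add (S.adj t) (x : H) y)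

theorem adjDom_apply_smul (S : StronglyContinuousGroup 𝕜 H) (t : ℝ) (c : 𝕜)
    (x : (S.generator†).domain) : S.adjDom t (c • x) = c • S.adjDom t x :=
  Subtype.ext (map_smul (S.adj t) c (x : H))

end ControlAdjoint

/-! ### Uniform boundedness and square integrable functions. -/

section Duality

/-- A weighted form of the uniform boundedness principle for families of vectors. -/
theorem exists_norm_le_mul_of_forall_inner {𝕜 E ι : Type*} [RCLike 𝕜] [NormedAddCommGroup E]
    [InnerProductSpace 𝕜 E] [CompleteSpace E] (a : ι → E) (b : ι → ℝ) (hb : ∀ i, 0 ≤ b i)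
    (h : ∀ x : E, ∃ C : ℝ, ∀ i, ‖inner 𝕜 (a i) x‖ ≤ C * b i) :
    ∃ C : ℝ, 0 ≤ C ∧ ∀ i, ‖a i‖ ≤ C * b i := by
  have h' : ∀ x, ∃ C, ∀ i, ‖((((b i)⁻¹ : ℝ) : 𝕜) • innerSL 𝕜 (a i)) x‖ ≤ C := by
    intro x
    obtain ⟨C, hC⟩ := h x
    refine ⟨max C 0, fun i => ?_⟩
    rw [smul_apply, norm_smul, innerSL_apply_apply, RCLike.norm_ofReal,
      abs_of_nonneg (inv_nonneg.2 (hb i))]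
    rcases (hb i).eq_or_lt with h0 | h0
    · rw [← h0]; simp
    · rw [inv_mul_le_iff₀ h0, mul_comm]
      exact (hC i).trans (mul_le_mul_of_nonneg_right (le_max_left _ _) h0.le)
  obtain ⟨C, hC⟩ := banach_steinhaus h'
  refine ⟨max C 0, le_max_right _ _, fun i => ?_⟩
  rcases (hb i).eq_or_lt with h0 | h0
  -- The rescaled family vanishes at an index of weight `0`, so there the hypothesis is tested on `a
  -- i` itself, which forces `a i = 0`.
  · obtain ⟨D, hD⟩ := h (a i)
    have h1 := hD i
    rw [← h0, mul_zero, norm_le_zero_iff, inner_self_eq_zero] at h1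
    rw [h1, ← h0]; simp
  · have h1 := hC i
    rw [norm_smul, innerSL_apply_norm, RCLike.norm_ofReal,
      abs_of_nonneg (inv_nonneg.2 (hb i)), inv_mul_le_iff₀ h0, mul_comm] at h1
    exact h1.trans (mul_le_mul_of_nonneg_right (le_max_left _ _) h0.le)

end Duality

section SquareIntegrable

variable {𝕜 U : Type*} [RCLike 𝕜] [NormedAddCommGroup U] [InnerProductSpace 𝕜 U]

theorem _root_.Continuous.memLp_restrict_Ioo {f : ℝ → U} (hf : Continuous f) (a b : ℝ) (p : ℝ≥0∞) :
    MemLp f p (volume.restrict (Set.Ioo a b)) := by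
  obtain ⟨C, hC⟩ := ((isCompact_Icc (a := a) (b := b)).image hf).isBounded.exists_norm_le
  refine MemLp.of_bound hf.aestronglyMeasurable C ?_
  filter_upwards [ae_restrict_mem measurableSet_Ioo] with s hs
  exact hC _ ⟨s, Set.Ioo_subset_Icc_self hs, rfl⟩

theorem norm_toLp_sq (𝕜 : Type*) {U : Type*} [RCLike 𝕜] [NormedAddCommGroup U]
    [InnerProductSpace 𝕜 U] {μ : Measure ℝ} {f : ℝ → U} (hf : MemLp f 2 μ) :
    ‖hf.toLp f‖ ^ 2 = ∫ s, ‖f s‖ ^ 2 ∂μ := by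
  have h : ((‖hf.toLp f‖ ^ 2 : ℝ) : 𝕜) = ((∫ s, ‖f s‖ ^ 2 ∂μ : ℝ) : 𝕜) := by
    rw [← integral_ofReal, RCLike.ofReal_pow, ← inner_self_eq_norm_sq_to_K (𝕜 := 𝕜), L2.inner_def]
    refine integral_congr_ae ?_
    filter_upwards [hf.coeFn_toLp] with s hs
    rw [hs, RCLike.ofReal_pow, inner_self_eq_norm_sq_to_K]
  exact_mod_cast h

theorem inner_toLp {μ : Measure ℝ} {f g : ℝ → U} (hf : MemLp f 2 μ) (hg : MemLp g 2 μ) :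
    inner 𝕜 (hf.toLp f) (hg.toLp g) = ∫ s, inner 𝕜 (f s) (g s) ∂μ := by
  rw [L2.inner_def]
  refine integral_congr_ae ?_
  filter_upwards [hf.coeFn_toLp, hg.coeFn_toLp] with s hs hs'
  rw [hs, hs']

end SquareIntegrable

/-! ### Finite and infinite time observation estimates. -/

section

variable {𝕜 H U : Type*} [RCLike 𝕜]
  [NormedAddCommGroup H] [InnerProductSpace 𝕜 H] [CompleteSpace H]
  [NormedAddCommGroup U] [InnerProductSpace 𝕜 U] [CompleteSpace U]

theorem continuous_controlAdjoint_sub (S : StronglyContinuousGroup 𝕜 H)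
    (B : U →L[𝕜] DualDomain S.generator) (T : ℝ) (φ : (S.generator†).domain) :
    Continuous fun s => controlAdjoint B (S.adjDom (T - s) φ) :=
  (continuous_controlAdjoint S B φ).comp (continuous_const.sub continuous_id)

theorem continuous_controlAdjoint_neg (S : StronglyContinuousGroup 𝕜 H)
    (B : U →L[𝕜] DualDomain S.generator) (φ : (S.generator†).domain) :
    Continuous fun s => controlAdjoint B (S.adjDom (-s) φ) :=
  (continuous_controlAdjoint S B φ).comp continuous_neg

theorem adjDom_neg_eq (S : StronglyContinuousGroup 𝕜 H) (T s : ℝ) (φ : (S.generator†).domain) :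
    S.adjDom (-s) φ = S.adjDom (T - s) (S.adjDom (-T) φ) := by
  rw [← S.adjDom_add]; congr 1; ring

theorem IsAdmissible.exists_observation_le {S : StronglyContinuousGroup 𝕜 H}
    {B : U →L[𝕜] DualDomain S.generator} (hB : IsAdmissible S B) {T : ℝ} (hT : 0 < T) :
    ∃ K : ℝ, 0 ≤ K ∧ ∀ φ : (S.generator†).domain,
      ∫ s in (0 : ℝ)..T, ‖controlAdjoint B (S.adjDom (-s) φ)‖ ^ 2 ≤ K * ‖(φ : H)‖ ^ 2 := by
  have hg : ∀ φ, MemLp (fun s => controlAdjoint B (S.adjDom (T - s) φ)) 2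
      (volume.restrict (Set.Ioo 0 T)) :=
    fun φ => (continuous_controlAdjoint_sub S B T φ).memLp_restrict_Ioo _ _ _
  obtain ⟨C, hC0, hC⟩ := exists_norm_le_mul_of_forall_inner (𝕜 := 𝕜)
    (fun φ : (S.generator†).domain => (hg φ).toLp _) (fun φ => ‖(φ : H)‖)
    (fun _ => norm_nonneg _) (by
      intro u
      obtain ⟨y, -, hy⟩ := hB T hT u (Lp.memLp u)
      refine ⟨‖y T‖, fun φ => ?_⟩
      have h1 : inner 𝕜 u ((hg φ).toLp _) = inner 𝕜 (y T) (φ : H) := by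
        rw [hy T ⟨hT.le, le_rfl⟩ φ, ← inner_toLp (Lp.memLp u) (hg φ), Lp.toLp_coeFn]
      rw [norm_inner_symm, h1]
      exact norm_inner_le_norm _ _)
  refine ⟨(C * ‖S.adj (-T)‖) ^ 2, by positivity, fun φ => ?_⟩
  -- Starting from `e^{-T A^*} φ` turns the exponent `T - s` of the controlled problem into `-s`.
  have h1 := hC (S.adjDom (-T) φ)
  have h2 : ‖((S.adjDom (-T) φ : (S.generator†).domain) : H)‖ ≤ ‖S.adj (-T)‖ * ‖(φ : H)‖ :=
    (S.adj (-T)).le_opNorm _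
  have h3 := h1.trans (mul_le_mul_of_nonneg_left h2 hC0)
  have h4 := pow_le_pow_left₀ (norm_nonneg _) h3 2
  rw [norm_toLp_sq 𝕜, ← integral_Ioc_eq_integral_Ioo,
    ← intervalIntegral.integral_of_le hT.le] at h4
  simp only [← adjDom_neg_eq] at h4
  exact h4.trans (le_of_eq (by ring))

/-- Since the growth bound is an infimum over times, one time at which the quotient is below `λ` is
enough. -/
theorem exists_norm_adj_mul_exp_lt_one {S : StronglyContinuousGroup 𝕜 H} {lam : ℝ}
    (hlam : growthBound (fun s : ℝ => S.adj (-s)) < (lam : EReal)) :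
    ∃ t : ℝ, 0 < t ∧ Real.exp (-lam * t) * ‖S.adj (-t)‖ < 1 := by
  simp only [growthBound, iInf_lt_iff] at hlam
  obtain ⟨t, ht, h⟩ := hlam
  refine ⟨t, ht, ?_⟩
  rw [EReal.div_lt_iff (by exact_mod_cast ht) (EReal.coe_ne_top t), ← EReal.coe_mul,
    ← Real.log_exp (lam * t), ← ENNReal.log_ofReal_of_pos (Real.exp_pos _),
    ENNReal.log_lt_log_iff, ← ofReal_norm, ENNReal.ofReal_lt_ofReal_iff (Real.exp_pos _)] at h
  rw [neg_mul, Real.exp_neg, inv_mul_lt_iff₀ (Real.exp_pos _), mul_one]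
  exact h

/-- The function `s ↦ e^{-λ s} B^* e^{-s A^*} φ` for `φ ∈ 𝓓(A^*)`. -/
def weightedOutput (S : StronglyContinuousGroup 𝕜 H) (B : U →L[𝕜] DualDomain S.generator)
    (lam : ℝ) (φ : (S.generator†).domain) (s : ℝ) : U :=
  ((Real.exp (-lam * s) : ℝ) : 𝕜) • controlAdjoint B (S.adjDom (-s) φ)

theorem continuous_weightedOutput (S : StronglyContinuousGroup 𝕜 H)
    (B : U →L[𝕜] DualDomain S.generator) (lam : ℝ) (φ : (S.generator†).domain) :
    Continuous (weightedOutput S B lam φ) := by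
  refine Continuous.smul ?_ (continuous_controlAdjoint_neg S B φ)
  exact RCLike.continuous_ofReal.comp (by fun_prop)

theorem weightedOutput_apply_add (S : StronglyContinuousGroup 𝕜 H)
    (B : U →L[𝕜] DualDomain S.generator) (lam : ℝ) (x y : (S.generator†).domain) :
    weightedOutput S B lam (x + y) = weightedOutput S B lam x + weightedOutput S B lam y := by
  funext s
  simp only [weightedOutput, adjDom_apply_add, controlAdjoint_add, smul_add, Pi.add_apply]

theorem weightedOutput_apply_smul (S : StronglyContinuousGroup 𝕜 H)
    (B : U →L[𝕜] DualDomain S.generator) (lam : ℝ) (c : 𝕜) (x : (S.generator†).domain) :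
    weightedOutput S B lam (c • x) = c • weightedOutput S B lam x := by
  funext s
  simp only [weightedOutput, adjDom_apply_smul, controlAdjoint_smul, Pi.smul_apply]
  rw [smul_comm]

/-- A time shift is absorbed into the initial state. This drives both the block iteration and the
operator identity. -/
theorem weightedOutput_add (S : StronglyContinuousGroup 𝕜 H)
    (B : U →L[𝕜] DualDomain S.generator) (lam : ℝ) (φ : (S.generator†).domain) (t s : ℝ) :
    weightedOutput S B lam φ (t + s) =
      weightedOutput S B lam (((Real.exp (-lam * t) : ℝ) : 𝕜) • S.adjDom (-t) φ) s := by
  rw [weightedOutput_apply_smul, Pi.smul_apply, weightedOutput, weightedOutput, smul_smul,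
    ← S.adjDom_add, ← RCLike.ofReal_mul, ← Real.exp_add]
  congr 3 <;> [congr 1; skip] <;> ring_nf

theorem norm_weightedOutput (S : StronglyContinuousGroup 𝕜 H)
    (B : U →L[𝕜] DualDomain S.generator) (lam : ℝ) (φ : (S.generator†).domain) (s : ℝ) :
    ‖weightedOutput S B lam φ s‖ =
      Real.exp (-lam * s) * ‖controlAdjoint B (S.adjDom (-s) φ)‖ := by
  rw [weightedOutput, norm_smul, RCLike.norm_ofReal, Real.abs_exp]

theorem exp_mul_le_exp_abs_mul {lam s T : ℝ} (hs : 0 ≤ s) (hsT : s ≤ T) :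
    Real.exp (lam * s) ≤ Real.exp (|lam| * T) := by
  rw [Real.exp_le_exp]
  exact (mul_le_mul_of_nonneg_right (le_abs_self _) hs).trans
    (mul_le_mul_of_nonneg_left hsT (abs_nonneg _))

theorem IsAdmissible.exists_integral_weightedOutput_le {S : StronglyContinuousGroup 𝕜 H}
    {B : U →L[𝕜] DualDomain S.generator} (hB : IsAdmissible S B) {lam : ℝ}
    (hlam : growthBound (fun s : ℝ => S.adj (-s)) < (lam : EReal)) :
    ∃ K : ℝ, 0 ≤ K ∧ ∀ φ : (S.generator†).domain,
      IntegrableOn (fun s => ‖weightedOutput S B lam φ s‖ ^ 2) (Set.Ioi 0) ∧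
      ∫ s in Set.Ioi (0 : ℝ), ‖weightedOutput S B lam φ s‖ ^ 2 ≤ K * ‖(φ : H)‖ ^ 2 := by
  obtain ⟨t, ht, hρ⟩ := exists_norm_adj_mul_exp_lt_one hlam
  set ρ := Real.exp (-lam * t) * ‖S.adj (-t)‖ with hρdef
  have hρ0 : 0 ≤ ρ := by positivity
  obtain ⟨K, hK0, hK⟩ := hB.exists_observation_le ht
  have hcont : ∀ φ, Continuous fun s => ‖weightedOutput S B lam φ s‖ ^ 2 :=
    fun φ => (continuous_weightedOutput S B lam φ).norm.pow 2
  -- `L` is the cost of the first block: the finite time constant times a crude bound for the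
  -- squared weight.
  set L := Real.exp (|-lam| * t) ^ 2 * K with hL
  have hL0 : 0 ≤ L := by positivity
  have hfirst : ∀ φ : (S.generator†).domain,
      ∫ s in (0 : ℝ)..t, ‖weightedOutput S B lam φ s‖ ^ 2 ≤ L * ‖(φ : H)‖ ^ 2 := by
    intro φ
    calc ∫ s in (0 : ℝ)..t, ‖weightedOutput S B lam φ s‖ ^ 2
        ≤ ∫ s in (0 : ℝ)..t,
            Real.exp (|-lam| * t) ^ 2 * ‖controlAdjoint B (S.adjDom (-s) φ)‖ ^ 2 := by
          refine intervalIntegral.integral_mono_on ht.le ((hcont φ).intervalIntegrable _ _)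
            ((continuous_const.mul
              ((continuous_controlAdjoint_neg S B φ).norm.pow 2)).intervalIntegrable _ _) ?_
          intro s hs
          rw [norm_weightedOutput, mul_pow]
          refine mul_le_mul_of_nonneg_right (pow_le_pow_left₀ (Real.exp_pos _).le ?_ 2) (by positivity)
          exact exp_mul_le_exp_abs_mul hs.1 hs.2
      _ ≤ L * ‖(φ : H)‖ ^ 2 := by
          rw [intervalIntegral.integral_const_mul, hL, mul_assoc]
          exact mul_le_mul_of_nonneg_left (hK φ) (by positivity)
  have hρ1 : 0 < 1 - ρ ^ 2 := by nlinarith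
  -- The constant `L / (1 - ρ²)` solves `c = L + ρ² c`, so the induction that splits off the first
  -- block closes with a bound independent of `n`. It must range over all `φ`, because the initial
  -- state changes.
  have hbound : ∀ (n : ℕ) (φ : (S.generator†).domain),
      ∫ s in (0 : ℝ)..(n * t), ‖weightedOutput S B lam φ s‖ ^ 2
        ≤ L / (1 - ρ ^ 2) * ‖(φ : H)‖ ^ 2 := by
    intro n
    induction n with
    | zero => intro φ; simp; positivity
    | succ n ih =>
      intro φ
      have hsplit := intervalIntegral.integral_add_adjacent_intervals
        ((hcont φ).intervalIntegrable 0 t : IntervalIntegrable _ volume 0 t)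
        ((hcont φ).intervalIntegrable t (t + n * t))
      have hshift := intervalIntegral.integral_comp_add_left (a := 0) (b := n * t)
        (fun s => ‖weightedOutput S B lam φ s‖ ^ 2) t
      rw [add_zero] at hshift
      have e : ((n + 1 : ℕ) : ℝ) * t = t + n * t := by push_cast; ring
      rw [e, ← hsplit, ← hshift]
      simp only [weightedOutput_add]
      have h1 := ih (((Real.exp (-lam * t) : ℝ) : 𝕜) • S.adjDom (-t) φ)
      have h2 : ‖((((Real.exp (-lam * t) : ℝ) : 𝕜) • S.adjDom (-t) φ : (S.generator†).domain) : H)‖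
          ≤ ρ * ‖(φ : H)‖ := by
        rw [Submodule.coe_smul, norm_smul, RCLike.norm_ofReal, Real.abs_exp, hρdef, mul_assoc]
        exact mul_le_mul_of_nonneg_left ((S.adj (-t)).le_opNorm _) (Real.exp_pos _).le
      have h3 := pow_le_pow_left₀ (norm_nonneg _) h2 2
      calc _ ≤ L * ‖(φ : H)‖ ^ 2 + L / (1 - ρ ^ 2) * (ρ * ‖(φ : H)‖) ^ 2 :=
            add_le_add (hfirst φ)
              (h1.trans (mul_le_mul_of_nonneg_left h3 (by positivity)))
        _ = _ := by field_simp; ring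
  refine ⟨L / (1 - ρ ^ 2), by positivity, fun φ => ?_⟩
  have hlim : Tendsto (fun n : ℕ => (n : ℝ) * t) atTop atTop :=
    tendsto_natCast_atTop_atTop.atTop_mul_const ht
  have hint : IntegrableOn (fun s => ‖weightedOutput S B lam φ s‖ ^ 2) (Set.Ioi 0) := by
    refine integrableOn_Ioi_of_intervalIntegral_norm_bounded
      (L / (1 - ρ ^ 2) * ‖(φ : H)‖ ^ 2) 0
      (fun n => (hcont φ).integrableOn_Ioc) hlim (Eventually.of_forall fun n => ?_)
    simpa using hbound n φ
  exact ⟨hint, le_of_tendsto (intervalIntegral_tendsto_integral_Ioi 0 hint hlim)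
    (Eventually.of_forall fun n => hbound n φ)⟩

/-- The extension of `φ ↦ e^{-λ s} B^* e^{-s A^*} φ` to a bounded operator into `L²(0, ∞; U)`. -/
theorem IsAdmissible.exists_extension {S : StronglyContinuousGroup 𝕜 H}
    {B : U →L[𝕜] DualDomain S.generator} (hB : IsAdmissible S B) {lam : ℝ}
    (hlam : growthBound (fun s : ℝ => S.adj (-s)) < (lam : EReal)) :
    ∃ Ψ : H →L[𝕜] Lp U 2 (volume.restrict (Set.Ioi (0 : ℝ))), ∀ φ : (S.generator†).domain,
      Ψ φ =ᵐ[volume.restrict (Set.Ioi (0 : ℝ))] weightedOutput S B lam φ := by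
  obtain ⟨K, hK0, hK⟩ := hB.exists_integral_weightedOutput_le hlam
  have hmem : ∀ φ, MemLp (weightedOutput S B lam φ) 2 (volume.restrict (Set.Ioi (0 : ℝ))) :=
    fun φ => (memLp_two_iff_integrable_sq_norm
      (continuous_weightedOutput S B lam φ).aestronglyMeasurable).2 (hK φ).1
  let f : (S.generator†).domain →ₗ[𝕜] Lp U 2 (volume.restrict (Set.Ioi (0 : ℝ))) :=
    { toFun := fun φ => (hmem φ).toLp _
      map_add' := fun x y => by
        rw [← MemLp.toLp_add]
        exact MemLp.toLp_congr _ _ (by rw [weightedOutput_apply_add])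
      map_smul' := fun c x => by
        rw [RingHom.id_apply, ← MemLp.toLp_const_smul]
        exact MemLp.toLp_congr _ _ (by rw [weightedOutput_apply_smul]) }
  have hdense : DenseRange (S.generator†).domain.subtype := by
    simpa [DenseRange] using S.dense_adjoint_domain
  have hnorm : ∃ C, ∀ φ, ‖f φ‖ ≤ C * ‖(S.generator†).domain.subtype φ‖ := by
    refine ⟨√K, fun φ => ?_⟩
    refine le_of_sq_le_sq ?_ (by positivity)
    rw [mul_pow, Real.sq_sqrt hK0]
    exact (norm_toLp_sq 𝕜 (hmem φ)).trans_le (hK φ).2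
  refine ⟨f.extendOfNorm (S.generator†).domain.subtype, fun φ => ?_⟩
  have h := LinearMap.extendOfNorm_eq hdense hnorm φ
  rw [Submodule.subtype_apply] at h
  rw [h]
  exact (hmem φ).coeFn_toLp

end

/-! ### Outputs, the Gramian and its operator identity. -/

theorem integral_Ioi_comp_add {E : Type*} [NormedAddCommGroup E] [NormedSpace ℝ E] (f : ℝ → E)
    (a h : ℝ) : ∫ s in Set.Ioi a, f (h + s) = ∫ s in Set.Ioi (h + a), f s := by
  rw [← (measurePreserving_add_left volume h).setIntegral_preimage_emb
    (measurableEmbedding_addLeft h) f (Set.Ioi (h + a))]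
  simp

section

variable {𝕜 H U : Type*} [RCLike 𝕜]
  [NormedAddCommGroup H] [InnerProductSpace 𝕜 H] [CompleteSpace H]
  [NormedAddCommGroup U] [InnerProductSpace 𝕜 U] [CompleteSpace U]

theorem comap_domain_neBot (S : StronglyContinuousGroup 𝕜 H) (z : H) :
    (comap (Subtype.val : (S.generator†).domain → H) (𝓝 z)).NeBot :=
  S.dense_adjoint_domain.isDenseInducing_val.comap_nhds_neBot z

/-- Removing the weight costs at most the factor `e^{|λ| T}` on `(0, T)`, so continuity of `Ψ` gives
`L²` convergence on each bounded interval. -/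
theorem isOutput_of_extension {S : StronglyContinuousGroup 𝕜 H}
    {B : U →L[𝕜] DualDomain S.generator} {lam : ℝ}
    {Ψ : H →L[𝕜] Lp U 2 (volume.restrict (Set.Ioi (0 : ℝ)))}
    (hΨ : ∀ φ : (S.generator†).domain,
      Ψ φ =ᵐ[volume.restrict (Set.Ioi (0 : ℝ))] weightedOutput S B lam φ) (z : H) :
    IsOutput S B z fun s => ((Real.exp (lam * s) : ℝ) : 𝕜) • Ψ z s := by
  intro T hT
  have hle : volume.restrict (Set.Ioo 0 T) ≤ volume.restrict (Set.Ioi (0 : ℝ)) :=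
    Measure.restrict_mono Set.Ioo_subset_Ioi_self le_rfl
  have hexp : Continuous fun s : ℝ => ((Real.exp (lam * s) : ℝ) : 𝕜) :=
    RCLike.continuous_ofReal.comp (by fun_prop)
  have hbd : ∀ s ∈ Set.Ioo 0 T, ∀ v : U, ‖((Real.exp (lam * s) : ℝ) : 𝕜) • v‖ ≤
      Real.exp (|lam| * T) * ‖v‖ := by
    intro s hs v
    rw [norm_smul, RCLike.norm_ofReal, Real.abs_exp]
    exact mul_le_mul_of_nonneg_right (exp_mul_le_exp_abs_mul hs.1.le hs.2.le) (norm_nonneg _)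
  have hz : MemLp (Ψ z) 2 (volume.restrict (Set.Ioo 0 T)) := (Lp.memLp (Ψ z)).mono_measure hle
  refine ⟨hz.of_le_mul (c := Real.exp (|lam| * T))
    (hexp.aestronglyMeasurable.smul hz.1) ?_, ?_⟩
  · filter_upwards [ae_restrict_mem measurableSet_Ioo] with s hs using hbd s hs _
  have hlim : Tendsto (fun φ : (S.generator†).domain =>
      ENNReal.ofReal (Real.exp (|lam| * T)) * edist (Ψ φ) (Ψ z))
      (comap (Subtype.val : (S.generator†).domain → H) (𝓝 z)) (𝓝 0) := by
    have h1 : Tendsto (fun x => edist (Ψ x) (Ψ z)) (𝓝 z) (𝓝 0) := by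
      rw [← tendsto_iff_edist_tendsto_0]
      exact Ψ.continuous.tendsto z
    have h2 := ENNReal.Tendsto.const_mul (a := ENNReal.ofReal (Real.exp (|lam| * T)))
      (h1.comp (tendsto_comap (f := (Subtype.val : (S.generator†).domain → H)))) (Or.inr ENNReal.ofReal_ne_top)
    rw [mul_zero] at h2
    exact h2
  refine tendsto_of_tendsto_of_tendsto_of_le_of_le tendsto_const_nhds hlim
    (fun _ => zero_le) fun φ => ?_
  rw [Lp.edist_def]
  refine (eLpNorm_le_mul_eLpNorm_of_ae_le_mul (g := ⇑(Ψ φ) - ⇑(Ψ z)) ?_ 2).trans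
    (mul_le_mul_right (eLpNorm_mono_measure _ hle) _)
  filter_upwards [ae_restrict_mem measurableSet_Ioo, ae_mono hle (hΨ φ)] with s hs h
  rw [Pi.sub_apply]
  convert hbd s hs (Ψ φ s - Ψ z s) using 2
  rw [h, weightedOutput, smul_sub, smul_smul, ← RCLike.ofReal_mul, ← Real.exp_add]
  simp

/-- Both functions are limits of the same family along a filter that is nontrivial because `𝓓(A^*)`
is dense. -/
theorem IsOutput.ae_eq {S : StronglyContinuousGroup 𝕜 H}
    {B : U →L[𝕜] DualDomain S.generator} {z : H} {w w' : ℝ → U}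
    (h : IsOutput S B z w) (h' : IsOutput S B z w') :
    w =ᵐ[volume.restrict (Set.Ioi (0 : ℝ))] w' := by
  have key : ∀ T : ℝ, 0 < T → w =ᵐ[volume.restrict (Set.Ioo 0 T)] w' := by
    intro T hT
    obtain ⟨hw, hlim⟩ := h T hT
    obtain ⟨hw', hlim'⟩ := h' T hT
    have := comap_domain_neBot S z
    have h0 := hlim.add hlim'
    rw [add_zero] at h0
    have h1 : eLpNorm (w' - w) 2 (volume.restrict (Set.Ioo 0 T)) ≤ 0 := by
      refine ge_of_tendsto h0 (Eventually.of_forall fun φ => ?_)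
      have hc := (continuous_controlAdjoint_neg S B φ).aestronglyMeasurable
        (μ := volume.restrict (Set.Ioo 0 T))
      have h2 := eLpNorm_sub_le (p := 2) (hc.sub hw.1) (hc.sub hw'.1) one_le_two
      rw [sub_sub_sub_cancel_left] at h2
      exact h2
    rw [nonpos_iff_eq_zero, eLpNorm_eq_zero_iff (hw'.1.sub hw.1) two_ne_zero] at h1
    filter_upwards [h1] with s hs
    exact (sub_eq_zero.1 hs).symm
  have hU : Set.Ioi (0 : ℝ) = ⋃ n : ℕ, Set.Ioo (0 : ℝ) (n + 1) := by
    ext s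
    simp only [Set.mem_Ioi, Set.mem_iUnion, Set.mem_Ioo]
    refine ⟨fun hs => ?_, fun ⟨_, hs, _⟩ => hs⟩
    obtain ⟨n, hn⟩ := exists_nat_gt s
    exact ⟨n, hs, by linarith⟩
  rw [Filter.EventuallyEq, hU, ae_restrict_iUnion_iff]
  exact fun n => key _ (by positivity)

/-- The operator `Ψ^* W Ψ`. -/
def gramian (Ψ : H →L[𝕜] Lp U 2 (volume.restrict (Set.Ioi (0 : ℝ)))) (W : U →L[𝕜] U) :
    H →L[𝕜] H :=
  (ContinuousLinearMap.adjoint Ψ).comp ((W.compLpL 2 _).comp Ψ)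

theorem inner_gramian (Ψ : H →L[𝕜] Lp U 2 (volume.restrict (Set.Ioi (0 : ℝ)))) (W : U →L[𝕜] U)
    (z₁ z₂ : H) :
    inner 𝕜 (gramian Ψ W z₁) z₂ = ∫ s in Set.Ioi (0 : ℝ), inner 𝕜 (W (Ψ z₁ s)) (Ψ z₂ s) := by
  rw [gramian, ContinuousLinearMap.comp_apply, ContinuousLinearMap.adjoint_inner_left, L2.inner_def]
  refine integral_congr_ae ?_
  filter_upwards [W.coeFn_compLpL (Ψ z₁)] with s hs
  rw [ContinuousLinearMap.comp_apply, hs]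

set_option linter.unusedSectionVars false in
theorem integrable_inner_extension (Ψ : H →L[𝕜] Lp U 2 (volume.restrict (Set.Ioi (0 : ℝ))))
    (W : U →L[𝕜] U) (z₁ z₂ : H) :
    IntegrableOn (fun s => inner 𝕜 (W (Ψ z₁ s)) (Ψ z₂ s)) (Set.Ioi (0 : ℝ)) := by
  refine (L2.integrable_inner (𝕜 := 𝕜) (W.compLpL 2 _ (Ψ z₁)) (Ψ z₂)).congr ?_
  filter_upwards [W.coeFn_compLpL (Ψ z₁)] with s hs
  rw [hs]

theorem inner_gramian_symm (Ψ : H →L[𝕜] Lp U 2 (volume.restrict (Set.Ioi (0 : ℝ))))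
    {W : U →L[𝕜] U} (hW : ∀ u v : U, inner 𝕜 (W u) v = inner 𝕜 u (W v)) (z₁ z₂ : H) :
    inner 𝕜 (gramian Ψ W z₁) z₂ = inner 𝕜 z₁ (gramian Ψ W z₂) := by
  rw [← inner_conj_symm z₁, inner_gramian, inner_gramian, ← integral_conj]
  simp only [hW, inner_conj_symm]

theorem isGramian_gramian {S : StronglyContinuousGroup 𝕜 H}
    {B : U →L[𝕜] DualDomain S.generator} {lam : ℝ}
    {Ψ : H →L[𝕜] Lp U 2 (volume.restrict (Set.Ioi (0 : ℝ)))}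
    (hΨ : ∀ φ : (S.generator†).domain,
      Ψ φ =ᵐ[volume.restrict (Set.Ioi (0 : ℝ))] weightedOutput S B lam φ) (W : U →L[𝕜] U) :
    IsGramian S B W lam (gramian Ψ W) := by
  intro z₁ z₂ w₁ w₂ h₁ h₂
  have h : (fun s => inner 𝕜 (W (Ψ z₁ s)) (Ψ z₂ s)) =ᵐ[volume.restrict (Set.Ioi (0 : ℝ))]
      fun s : ℝ => ((Real.exp (-2 * lam * s) : ℝ) : 𝕜) * inner 𝕜 (W (w₁ s)) (w₂ s) := by
    filter_upwards [h₁.ae_eq (isOutput_of_extension hΨ z₁),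
      h₂.ae_eq (isOutput_of_extension hΨ z₂)] with s hs₁ hs₂
    rw [hs₁, hs₂, map_smul, inner_smul_left, inner_smul_right, RCLike.conj_ofReal, ← mul_assoc,
      ← mul_assoc, ← RCLike.ofReal_mul, ← RCLike.ofReal_mul, ← Real.exp_add, ← Real.exp_add]
    ring_nf
    simp
  rw [inner_gramian]
  exact ⟨(integrable_inner_extension Ψ W z₁ z₂).congr h, integral_congr_ae h⟩

/-- Existence of outputs is what gives uniqueness: without it the condition on `Q'` could hold
vacuously. -/
theorem isGramian_iff {S : StronglyContinuousGroup 𝕜 H}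
    {B : U →L[𝕜] DualDomain S.generator} {lam : ℝ} {W : U →L[𝕜] U}
    (hout : ∀ z : H, ∃ w : ℝ → U, IsOutput S B z w) {Q : H → H} (hQ : IsGramian S B W lam Q)
    (Q' : H → H) : IsGramian S B W lam Q' ↔ Q' = Q := by
  refine ⟨fun hQ' => funext fun z => ext_inner_right 𝕜 fun z' => ?_, fun h => h ▸ hQ⟩
  obtain ⟨w, hw⟩ := hout z
  obtain ⟨w', hw'⟩ := hout z'
  rw [(hQ' z z' w w' hw hw').2, (hQ z z' w w' hw hw').2]

theorem operatorIdentity_gramian {S : StronglyContinuousGroup 𝕜 H}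
    {B : U →L[𝕜] DualDomain S.generator} {lam : ℝ}
    {Ψ : H →L[𝕜] Lp U 2 (volume.restrict (Set.Ioi (0 : ℝ)))}
    (hΨ : ∀ φ : (S.generator†).domain,
      Ψ φ =ᵐ[volume.restrict (Set.Ioi (0 : ℝ))] weightedOutput S B lam φ) {W : U →L[𝕜] U}
    (hW : ∀ u v : U, inner 𝕜 (W u) v = inner 𝕜 u (W v)) :
    OperatorIdentity S.generator B (gramian Ψ W) 0 W lam := by
  intro x y
  let := NormedSpace.restrictScalars ℝ 𝕜 H
  have : IsScalarTower ℝ 𝕜 H := StronglyContinuousGroup.isScalarTower_restrictScalars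
  set Q := gramian Ψ W with hQ
  let F : ℝ → 𝕜 := fun s => inner 𝕜 (W (weightedOutput S B lam x s)) (weightedOutput S B lam y s)
  have hFc : Continuous F := (W.continuous.comp (continuous_weightedOutput S B lam x)).inner
    (continuous_weightedOutput S B lam y)
  have hdom : ∀ x' y' : (S.generator†).domain,
      (fun s => inner 𝕜 (W (Ψ x' s)) (Ψ y' s)) =ᵐ[volume.restrict (Set.Ioi (0 : ℝ))]
      fun s => inner 𝕜 (W (weightedOutput S B lam x' s)) (weightedOutput S B lam y' s) := by
    intro x' y'
    filter_upwards [hΨ x', hΨ y'] with s h h'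
    rw [h, h']
  have hFi : IntegrableOn F (Set.Ioi 0) := (integrable_inner_extension Ψ W x y).congr (hdom x y)
  let X : ℝ → H := fun h => S.adj (-h) x
  let Y : ℝ → H := fun h => S.adj (-h) y
  -- Both sides equal `∫ₕ^∞ F`: on the left by `weightedOutput_add` and translation. The two
  -- exponential factors come from the two slots of the inner product.
  have key : ∀ h : ℝ, ((Real.exp (-lam * h) : ℝ) : 𝕜) * (((Real.exp (-lam * h) : ℝ) : 𝕜) *
      inner 𝕜 (Q (X h)) (Y h)) = (∫ s in Set.Ioi (0 : ℝ), F s) - ∫ s in (0 : ℝ)..h, F s := by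
    intro h
    -- Negative `h` is needed for a two-sided derivative at `0`; on `[h, 0]` continuity of `F`
    -- suffices.
    have hFh : IntegrableOn F (Set.Ioi h) :=
      (hFi.union (hFc.integrableOn_Icc (a := h) (b := 0))).mono_set fun s hs => by
        rcases le_or_gt s 0 with h0 | h0
        · exact Or.inr ⟨(Set.mem_Ioi.1 hs).le, h0⟩
        · exact Or.inl h0
    rw [← intervalIntegral.integral_interval_add_Ioi hFi hFh, add_sub_cancel_left]
    have e1 := inner_gramian Ψ W
      (((((Real.exp (-lam * h) : ℝ) : 𝕜) • S.adjDom (-h) x : (S.generator†).domain) : H))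
      (((((Real.exp (-lam * h) : ℝ) : 𝕜) • S.adjDom (-h) y : (S.generator†).domain) : H))
    rw [integral_congr_ae (hdom _ _)] at e1
    simp only [← weightedOutput_add] at e1
    rw [integral_Ioi_comp_add F 0 h, add_zero, Submodule.coe_smul, Submodule.coe_smul, map_smul,
      inner_smul_left, inner_smul_right, RCLike.conj_ofReal] at e1
    exact e1
  have hX : ∀ φ : (S.generator†).domain,
      HasDerivAt (fun h : ℝ => S.adj (-h) φ) (-(S.generator† φ)) 0 := by
    intro φ
    have h1 := S.hasDerivAt_adj φ (-0)
    have h2 := HasDerivAt.scomp (h := fun r : ℝ => -r) 0 h1 (hasDerivAt_neg (0 : ℝ))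
    rw [neg_zero, S.adj_zero_apply, neg_one_smul] at h2
    exact h2
  have hQX : HasDerivAt (fun h : ℝ => Q (X h)) (Q (-(S.generator† x))) 0 :=
    ((Q.restrictScalars ℝ).hasFDerivAt (x := X 0)).comp_hasDerivAt 0 (hX x)
  have hexp : HasDerivAt (fun h : ℝ => ((Real.exp (-lam * h) : ℝ) : 𝕜)) ((-lam : ℝ) : 𝕜) 0 := by
    have h1 : HasDerivAt (fun h : ℝ => Real.exp (-lam * h)) (-lam) 0 := by
      simpa using ((hasDerivAt_id (0 : ℝ)).const_mul (-lam)).exp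
    exact (RCLike.ofRealCLM (K := 𝕜)).hasFDerivAt.comp_hasDerivAt 0 h1
  have hL := hexp.mul (hexp.mul (HasDerivAt.inner 𝕜 hQX (hX y)))
  have hR : HasDerivAt (fun h : ℝ => (∫ s in Set.Ioi (0 : ℝ), F s) - ∫ s in (0 : ℝ)..h, F s)
      (-(F 0)) 0 :=
    (intervalIntegral.integral_hasDerivAt_right (hFc.intervalIntegrable _ _)
      hFc.stronglyMeasurable.stronglyMeasurableAtFilter hFc.continuousAt).const_sub _
  have hLR := (hL.congr_of_eventuallyEq (Eventually.of_forall fun h => (key h).symm)).unique hR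
  have hF0 : F 0 = inner 𝕜 (W (controlAdjoint B x)) (controlAdjoint B y) := by
    simp [F, weightedOutput, S.adjDom_zero]
  have hX0 : X 0 = x := by simp [X, S.adj_zero_apply]
  rw [hF0] at hLR
  simp only [Pi.mul_apply, hX0, neg_zero, S.adj_zero_apply, mul_zero, Real.exp_zero, RCLike.ofReal_one, one_mul,
    map_neg, inner_neg_left, inner_neg_right] at hLR
  -- The derivative produces `⟨Q A^* x, y⟩`; symmetry identifies it with the term `⟨A^* x, Q y⟩` of
  -- the goal.
  rw [← inner_gramian_symm Ψ hW]
  simp only [zero_apply, inner_zero_left, add_zero]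
  linear_combination -hLR

end

/-! ### From distributional derivatives to primitives. -/

section FundamentalLemma

/-- A smooth approximation of the indicator of `(s, ∞)`, equal to `1` on `[s + 1 / m, ∞)`. -/
def smoothStep (m s r : ℝ) : ℝ := Real.smoothTransition (m * (r - s))

theorem contDiff_smoothStep (m s : ℝ) : ContDiff ℝ ∞ (smoothStep m s) :=
  Real.smoothTransition.contDiff.comp (contDiff_const.mul (contDiff_id.sub contDiff_const))

theorem smoothStep_of_le {m s r : ℝ} (hm : 0 < m) (h : r ≤ s) : smoothStep m s r = 0 :=
  Real.smoothTransition.zero_of_nonpos (mul_nonpos_of_nonneg_of_nonpos hm.le (sub_nonpos.2 h))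

theorem smoothStep_of_ge {m s r : ℝ} (hm : 0 < m) (h : s + 1 / m ≤ r) : smoothStep m s r = 1 := by
  refine Real.smoothTransition.one_of_one_le ?_
  have h1 : 1 / m ≤ r - s := by linarith
  rwa [div_le_iff₀' hm] at h1

theorem hasDerivAt_smoothStep (m s r : ℝ) :
    HasDerivAt (smoothStep m s) (m * deriv Real.smoothTransition (m * (r - s))) r := by
  have h1 : HasDerivAt Real.smoothTransition (deriv Real.smoothTransition (m * (r - s)))
      (m * (r - s)) :=
    ((Real.smoothTransition.contDiff (n := 1)).differentiable (by norm_num) _).hasDerivAt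
  have h2 : HasDerivAt (fun r => m * (r - s)) m r := by
    simpa using ((hasDerivAt_id r).sub_const s).const_mul m
  have h3 := h1.comp r h2
  rw [mul_comm] at h3
  exact h3

theorem continuous_deriv_smoothTransition : Continuous (deriv Real.smoothTransition) :=
  (Real.smoothTransition.contDiff (n := 1)).continuous_deriv le_rfl

theorem hasCompactSupport_deriv_smoothTransition :
    HasCompactSupport (deriv Real.smoothTransition) := by
  refine HasCompactSupport.intro (isCompact_Icc (a := (0 : ℝ)) (b := 1)) fun x hx => ?_
  rw [Set.mem_Icc, not_and_or, not_le, not_le] at hx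
  rcases hx with hx | hx
  · have h : Real.smoothTransition =ᶠ[𝓝 x] fun _ => 0 := by
      filter_upwards [eventually_lt_nhds hx] with r hr
      exact Real.smoothTransition.zero_of_nonpos hr.le
    rw [h.deriv_eq, deriv_const]
  · have h : Real.smoothTransition =ᶠ[𝓝 x] fun _ => 1 := by
      filter_upwards [eventually_gt_nhds hx] with r hr
      exact Real.smoothTransition.one_of_one_le hr.le
    rw [h.deriv_eq, deriv_const]

theorem integral_deriv_smoothTransition : ∫ x, deriv Real.smoothTransition x = 1 := by
  have h := integral_of_hasDerivAt_of_tendsto (f := Real.smoothTransition) (m := 0) (n := 1)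
    (f' := deriv Real.smoothTransition)
    (fun x => ((Real.smoothTransition.contDiff (n := 1)).differentiable (by norm_num) x).hasDerivAt)
    (continuous_deriv_smoothTransition.integrable_of_hasCompactSupport
      hasCompactSupport_deriv_smoothTransition)
    (tendsto_const_nhds.congr' (by
      filter_upwards [eventually_le_atBot 0] with x hx
      exact (Real.smoothTransition.zero_of_nonpos hx).symm))
    (tendsto_const_nhds.congr' (by
      filter_upwards [eventually_ge_atTop 1] with x hx
      exact (Real.smoothTransition.one_of_one_le hx).symm))
  rw [h, sub_zero]

variable {E : Type*} [NormedAddCommGroup E] [NormedSpace ℝ E]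

theorem integral_deriv_smoothStep_smul {m : ℝ} (hm : 0 < m) (s : ℝ) (f : ℝ → E) :
    ∫ r, deriv (smoothStep m s) r • f r =
      ∫ x, deriv Real.smoothTransition x • f (s + x / m) := by
  have h1 : ∀ r, deriv (smoothStep m s) r • f r =
      m • (fun x => deriv Real.smoothTransition x • f (s + x / m)) (m * (r - s)) := by
    intro r
    rw [(hasDerivAt_smoothStep m s r).deriv, mul_smul]
    simp only
    rw [mul_div_cancel_left₀ _ hm.ne', add_sub_cancel]
  simp only [h1]
  rw [integral_sub_right_eq_self
    (fun r => m • (deriv Real.smoothTransition (m * r) • f (s + m * r / m))) s, integral_smul,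
    Measure.integral_comp_mul_left (fun x => deriv Real.smoothTransition x • f (s + x / m)),
    smul_smul, abs_of_pos (inv_pos.2 hm), mul_inv_cancel₀ hm.ne', one_smul]

theorem integrable_deriv_smoothStep_smul {m : ℝ} (hm : 0 < m) (s : ℝ) {f : ℝ → E}
    (hf : Continuous f) : Integrable fun r => deriv (smoothStep m s) r • f r := by
  refine Continuous.integrable_of_hasCompactSupport ?_ ?_
  · exact ((contDiff_smoothStep m s).continuous_deriv (by simp)).smul hf
  · refine HasCompactSupport.intro (isCompact_Icc (a := s) (b := s + 1 / m)) fun x hx => ?_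
    rw [Set.mem_Icc, not_and_or, not_le, not_le] at hx
    have h0 : deriv (smoothStep m s) x = 0 := by
      rcases hx with hx | hx
      · have h : smoothStep m s =ᶠ[𝓝 x] fun _ => 0 := by
          filter_upwards [eventually_lt_nhds hx] with r hr using smoothStep_of_le hm hr.le
        rw [h.deriv_eq, deriv_const]
      · have h : smoothStep m s =ᶠ[𝓝 x] fun _ => 1 := by
          filter_upwards [eventually_gt_nhds hx] with r hr using smoothStep_of_ge hm hr.le
        rw [h.deriv_eq, deriv_const]
    rw [h0, zero_smul]

/-- The derivative of a steep step is an approximate identity at `s`; after rescaling, the kernel is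
fixed and only the argument of `f` moves, so dominated convergence applies. -/
theorem tendsto_integral_deriv_smoothStep_smul [CompleteSpace E] {f : ℝ → E} (hf : Continuous f)
    {C : ℝ} (hC : ∀ r, ‖f r‖ ≤ C) (s : ℝ) :
    Tendsto (fun n : ℕ => ∫ r, deriv (smoothStep ((n : ℝ) + 1) s) r • f r) atTop (𝓝 (f s)) := by
  have h1 : ∀ n : ℕ, ∫ r, deriv (smoothStep ((n : ℝ) + 1) s) r • f r =
      ∫ x, deriv Real.smoothTransition x • f (s + x / ((n : ℝ) + 1)) :=
    fun n => integral_deriv_smoothStep_smul (by positivity) s f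
  have h2 : f s = ∫ x, deriv Real.smoothTransition x • f s := by
    rw [integral_smul_const, integral_deriv_smoothTransition, one_smul]
  simp only [h1]
  rw [h2]
  refine tendsto_integral_of_dominated_convergence
    (fun x => ‖deriv Real.smoothTransition x‖ * C) ?_ ?_ ?_ ?_
  · exact fun n => (continuous_deriv_smoothTransition.smul
      (hf.comp (by fun_prop))).aestronglyMeasurable
  · exact (continuous_deriv_smoothTransition.integrable_of_hasCompactSupport
      hasCompactSupport_deriv_smoothTransition).norm.mul_const C
  · refine fun n => Eventually.of_forall fun x => ?_
    rw [norm_smul]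
    exact mul_le_mul_of_nonneg_left (hC _) (norm_nonneg _)
  · refine Eventually.of_forall fun x => Tendsto.const_smul ((hf.tendsto s).comp ?_) _
    have h3 : Tendsto (fun n : ℕ => s + x * (1 / ((n : ℝ) + 1))) atTop (𝓝 (s + x * 0)) :=
      (tendsto_one_div_add_atTop_nhds_zero_nat.const_mul x).const_add s
    simpa [div_eq_mul_inv] using h3

/-- A continuous function whose distributional derivative on `(a, b)` is the integrable function `g`
is a primitive of `g`. -/
theorem sub_eq_integral_of_distributional_deriv [CompleteSpace E] {a b : ℝ} (hab : a < b)
    {f g : ℝ → E} (hf : ContinuousOn f (Set.Icc a b))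
    (hg : IntegrableOn g (Set.Ioo a b))
    (h : ∀ η : ℝ → ℝ, ContDiff ℝ ∞ η → HasCompactSupport η → tsupport η ⊆ Set.Ioo a b →
      -∫ r in Set.Ioo a b, deriv η r • f r = ∫ r in Set.Ioo a b, η r • g r)
    {s t : ℝ} (hs : a < s) (hst : s < t) (ht : t < b) :
    f t - f s = ∫ r in s..t, g r := by
  -- A bounded continuous extension to the line, as the approximate identity requires.
  obtain ⟨F, hFc, hFf, C, hC⟩ : ∃ F : ℝ → E, Continuous F ∧ (∀ r ∈ Set.Icc a b, F r = f r) ∧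
      ∃ C : ℝ, ∀ r, ‖F r‖ ≤ C := by
    refine ⟨Set.IccExtend hab.le ((Set.Icc a b).domRestrict f), hf.domRestrict.Icc_extend', ?_, ?_⟩
    · intro r hr
      rw [Set.IccExtend_of_mem _ _ hr]; rfl
    · obtain ⟨C, hC⟩ := (isCompact_Icc.image_of_continuousOn hf).isBounded.exists_norm_le
      exact ⟨C, fun r => hC _ ⟨_, (Set.projIcc a b hab.le r).2, rfl⟩⟩
  -- These test functions tend to the indicator of `(s, t]`, and their derivatives to `δ_s - δ_t`.
  let η : ℕ → ℝ → ℝ := fun n r => smoothStep ((n : ℝ) + 1) s r - smoothStep ((n : ℝ) + 1) t r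
  have hpos : ∀ n : ℕ, (0 : ℝ) < (n : ℝ) + 1 := fun n => by positivity
  have hηc : ∀ n, ContDiff ℝ ∞ (η n) :=
    fun n => (contDiff_smoothStep _ s).sub (contDiff_smoothStep _ t)
  have hη0 : ∀ (n : ℕ) (r : ℝ), r ∉ Set.Icc s (t + 1 / ((n : ℝ) + 1)) → η n r = 0 := by
    intro n r hr
    rw [Set.mem_Icc, not_and_or, not_le, not_le] at hr
    rcases hr with hr | hr
    · simp only [η]
      rw [smoothStep_of_le (hpos n) hr.le, smoothStep_of_le (hpos n) (hr.le.trans hst.le), sub_zero]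
    · simp only [η]
      rw [smoothStep_of_ge (hpos n) hr.le, smoothStep_of_ge (hpos n) (by linarith), sub_self]
  have hηs : ∀ n, tsupport (η n) ⊆ Set.Icc s (t + 1 / ((n : ℝ) + 1)) := fun n =>
    closure_minimal (fun r hr => by_contra fun h' => hr (hη0 n r h')) isClosed_Icc
  have hleft : Tendsto (fun n : ℕ => -∫ r, deriv (η n) r • F r) atTop (𝓝 (-(F s - F t))) := by
    have h1 := ((tendsto_integral_deriv_smoothStep_smul hFc hC s).sub
      (tendsto_integral_deriv_smoothStep_smul hFc hC t)).neg
    refine h1.congr fun n => ?_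
    rw [← integral_sub (integrable_deriv_smoothStep_smul (hpos n) s hFc)
      (integrable_deriv_smoothStep_smul (hpos n) t hFc)]
    congr 2
    funext r
    have h2 : deriv (η n) r =
        deriv (smoothStep ((n : ℝ) + 1) s) r - deriv (smoothStep ((n : ℝ) + 1) t) r :=
      deriv_sub (hasDerivAt_smoothStep _ s r).differentiableAt
        (hasDerivAt_smoothStep _ t r).differentiableAt
    rw [h2, sub_smul]
  have hright : Tendsto (fun n : ℕ => ∫ r in Set.Ioo a b, η n r • g r) atTop
      (𝓝 (∫ r in Set.Ioo a b, (Set.Ioc s t).indicator g r)) := by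
    refine tendsto_integral_of_dominated_convergence (fun r => ‖g r‖) ?_ hg.norm ?_ ?_
    · exact fun n => (hηc n).continuous.aestronglyMeasurable.smul hg.aestronglyMeasurable
    · refine fun n => Eventually.of_forall fun r => ?_
      rw [norm_smul]
      refine mul_le_of_le_one_left (norm_nonneg _) ?_
      rw [Real.norm_eq_abs]
      exact abs_sub_le_of_nonneg_of_le (Real.smoothTransition.nonneg _)
        (Real.smoothTransition.le_one _) (Real.smoothTransition.nonneg _)
        (Real.smoothTransition.le_one _)
    · refine Eventually.of_forall fun r => ?_
      have hstep : ∀ p : ℝ, p < r → ∀ᶠ n : ℕ in atTop, smoothStep ((n : ℝ) + 1) p r = 1 := by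
        intro p hp
        have h1 := (tendsto_one_div_add_atTop_nhds_zero_nat (𝕜 := ℝ)).eventually_lt_const
          (sub_pos.2 hp)
        filter_upwards [h1] with n hn
        exact smoothStep_of_ge (hpos n) (by linarith)
      refine tendsto_const_nhds.congr' ?_
      rcases le_or_gt r s with hr | hr
      · refine Eventually.of_forall fun n => ?_
        rw [Set.indicator_of_notMem (fun h' => absurd h'.1 (not_lt.2 hr))]
        simp only [η]
        rw [smoothStep_of_le (hpos n) hr, smoothStep_of_le (hpos n) (hr.trans hst.le)]
        simp
      rcases le_or_gt r t with hr' | hr'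
      · filter_upwards [hstep s hr] with n hn
        rw [Set.indicator_of_mem (show r ∈ Set.Ioc s t from ⟨hr, hr'⟩)]
        simp only [η]
        rw [hn, smoothStep_of_le (hpos n) hr']
        simp
      · filter_upwards [hstep s hr, hstep t hr'] with n hn hn'
        rw [Set.indicator_of_notMem (fun h' => absurd h'.2 (not_le.2 hr'))]
        simp only [η]
        rw [hn, hn']
        simp
  -- The support reaches `t + 1 / (n + 1)`, which lies below `b` only for large `n`.
  have heq : ∀ᶠ n : ℕ in atTop, -∫ r, deriv (η n) r • F r = ∫ r in Set.Ioo a b, η n r • g r := by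
    have h1 := (tendsto_one_div_add_atTop_nhds_zero_nat (𝕜 := ℝ)).eventually_lt_const
      (sub_pos.2 ht)
    filter_upwards [h1] with n hn
    have hsub : tsupport (η n) ⊆ Set.Ioo a b := (hηs n).trans fun r hr =>
      ⟨hs.trans_le hr.1, hr.2.trans_lt (by linarith)⟩
    rw [← h (η n) (hηc n) (isCompact_Icc.of_isClosed_subset (isClosed_tsupport _) (hηs n)) hsub,
      ← setIntegral_eq_integral_of_forall_compl_eq_zero (s := Set.Ioo a b)]
    · congr 1
      refine setIntegral_congr_fun measurableSet_Ioo fun r hr => ?_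
      simp only [hFf r (Set.Ioo_subset_Icc_self hr)]
    · intro r hr
      have h2 : deriv (η n) r = 0 := by
        by_contra h3
        exact hr (hsub (support_deriv_subset h3))
      rw [h2, zero_smul]
  have hIoc : Set.Ioc s t ⊆ Set.Ioo a b := fun r hr => ⟨hs.trans hr.1, hr.2.trans_lt ht⟩
  have hfin := tendsto_nhds_unique (hleft.congr' heq) hright
  rw [neg_sub, hFf t ⟨(hs.trans hst).le, ht.le⟩, hFf s ⟨hs.le, (hst.trans ht).le⟩,
    setIntegral_indicator measurableSet_Ioc, Set.inter_eq_right.2 hIoc,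
    ← intervalIntegral.integral_of_le hst.le] at hfin
  exact hfin

/-- The difference of `f` and a primitive of `g` is constant inside the interval and continuous up
to the endpoints. -/
theorem sub_eq_integral_of_distributional_deriv_Icc [CompleteSpace E] {a b : ℝ} (hab : a < b)
    {f g : ℝ → E} (hf : ContinuousOn f (Set.Icc a b))
    (hg : IntegrableOn g (Set.Ioo a b))
    (h : ∀ η : ℝ → ℝ, ContDiff ℝ ∞ η → HasCompactSupport η → tsupport η ⊆ Set.Ioo a b →
      -∫ r in Set.Ioo a b, deriv η r • f r = ∫ r in Set.Ioo a b, η r • g r)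
    {s t : ℝ} (hs : s ∈ Set.Icc a b) (ht : t ∈ Set.Icc a b) :
    f t - f s = ∫ r in s..t, g r := by
  have hgi : IntegrableOn g (Set.uIcc a b) := by
    rwa [Set.uIcc_of_le hab.le, integrableOn_Icc_iff_integrableOn_Ioo]
  have hsub : ∀ {p q : ℝ}, p ∈ Set.Icc a b → q ∈ Set.Icc a b →
      IntervalIntegrable g volume p q := fun {p q} hp hq =>
    (hgi.mono_set (Set.uIcc_subset_uIcc (by rwa [Set.uIcc_of_le hab.le])
      (by rwa [Set.uIcc_of_le hab.le]))).intervalIntegrable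
  let P : ℝ → E := fun r => f r - ∫ x in a..r, g x
  have hP : ContinuousOn P (Set.Icc a b) := by
    refine hf.sub ?_
    have := intervalIntegral.continuousOn_primitive_interval (μ := volume) hgi
    rwa [Set.uIcc_of_le hab.le] at this
  have ha : a ∈ Set.Icc a b := ⟨le_rfl, hab.le⟩
  have hlt : ∀ p ∈ Set.Ioo a b, ∀ q ∈ Set.Ioo a b, p < q → P q = P p := by
    intro p hp q hq hpq
    have h1 := sub_eq_integral_of_distributional_deriv hab hf hg h hp.1 hpq hq.2
    have h2 := intervalIntegral.integral_add_adjacent_intervals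
      (hsub ha (Set.Ioo_subset_Icc_self hp))
      (hsub (Set.Ioo_subset_Icc_self hp) (Set.Ioo_subset_Icc_self hq))
    simp only [P]
    rw [← h2, ← h1]
    abel
  obtain ⟨c, hc⟩ : (Set.Ioo a b).Nonempty := Set.nonempty_Ioo.2 hab
  have hIoo : Set.EqOn P (fun _ => P c) (Set.Ioo a b) := by
    intro p hp
    rcases lt_trichotomy p c with h' | h' | h'
    · exact (hlt p hp c hc h').symm
    · rw [h']
    · exact hlt c hc p hp h'
  have hIcc : Set.EqOn P (fun _ => P c) (Set.Icc a b) :=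
    hIoo.of_subset_closure hP continuousOn_const Set.Ioo_subset_Icc_self
      (by rw [closure_Ioo hab.ne])
  have h1 := (hIcc ht).trans (hIcc hs).symm
  have h2 := intervalIntegral.integral_add_adjacent_intervals (hsub ha hs) (hsub hs ht)
  simp only [P] at h1
  rw [← h2] at h1
  rw [sub_eq_iff_eq_add] at h1 ⊢
  rw [h1]
  abel

/-- Telescoping over a partition of mesh below `δ` gives `‖D T - D 0‖ ≤ ε (V T - V 0)`, then `ε →
0`. This replaces a vanishing derivative when `D` need not be differentiable. -/
theorem eq_of_norm_sub_le_mul_of_dist_lt {E : Type*} [NormedAddCommGroup E] {D : ℝ → E} {V : ℝ → ℝ} {T : ℝ} (hT : 0 < T)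
    (h : ∀ ε > 0, ∃ δ > 0, ∀ a b, 0 ≤ a → a ≤ b → b ≤ T → b - a < δ →
      ‖D b - D a‖ ≤ ε * (V b - V a)) : D T = D 0 := by
  have key : ∀ ε > 0, ‖D T - D 0‖ ≤ ε * (V T - V 0) := by
    intro ε hε
    obtain ⟨δ, hδ, hD⟩ := h ε hε
    obtain ⟨n, hn⟩ := exists_nat_gt (T / δ)
    have hn0 : (0 : ℝ) < n := (div_pos hT hδ).trans hn
    have hstep : ∀ k : ℕ, k ≤ n → ‖D (k * (T / n)) - D 0‖ ≤ ε * (V (k * (T / n)) - V 0) := by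
      intro k
      induction k with
      | zero => intro _; simp
      | succ k ih =>
        intro hk
        have hTn : 0 < T / n := div_pos hT hn0
        have hk' : ((k + 1 : ℕ) : ℝ) ≤ n := by exact_mod_cast hk
        have h1 := hD (k * (T / n)) ((k + 1 : ℕ) * (T / n)) (by positivity)
          (mul_le_mul_of_nonneg_right (by push_cast; linarith) hTn.le)
          (by
            calc ((k + 1 : ℕ) : ℝ) * (T / n) ≤ n * (T / n) :=
                  mul_le_mul_of_nonneg_right hk' hTn.le
              _ = T := by field_simp)
          (by
            have e : ((k + 1 : ℕ) : ℝ) * (T / n) - k * (T / n) = T / n := by push_cast; ring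
            rw [e, div_lt_iff₀ hn0]
            rw [div_lt_iff₀ hδ] at hn
            linarith)
        calc _ ≤ _ := norm_sub_le_norm_sub_add_norm_sub _ (D (k * (T / n))) _
          _ ≤ _ := add_le_add h1 (ih (by omega))
          _ = _ := by ring
    have h2 := hstep n le_rfl
    rwa [mul_div_cancel₀ _ hn0.ne'] at h2
  have hlim : Tendsto (fun ε : ℝ => ε * (V T - V 0)) (𝓝[>] 0) (𝓝 0) := by
    have : Continuous fun ε : ℝ => ε * (V T - V 0) := by fun_prop
    have h1 := this.tendsto 0
    rw [zero_mul] at h1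
    exact h1.mono_left nhdsWithin_le_nhds
  have h0 := ge_of_tendsto hlim (eventually_mem_nhdsWithin.mono fun ε hε => key ε hε)
  exact sub_eq_zero.1 (norm_le_zero_iff.1 h0)

end FundamentalLemma

/-! ### Variation of constants, observability and invertibility. -/

theorem integrableOn_inner_of_memLp {𝕜 U : Type*} [RCLike 𝕜] [NormedAddCommGroup U]
    [InnerProductSpace 𝕜 U] {T : ℝ} {u c : ℝ → U}
    (hu : MemLp u 2 (volume.restrict (Set.Ioo 0 T))) (hc : Continuous c) :
    IntegrableOn (fun s => inner 𝕜 (u s) (c s)) (Set.Icc 0 T) := by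
  rw [integrableOn_Icc_iff_integrableOn_Ioo]
  refine (L2.integrable_inner (𝕜 := 𝕜) (hu.toLp u)
    ((hc.memLp_restrict_Ioo 0 T 2).toLp c)).congr ?_
  filter_upwards [hu.coeFn_toLp, (hc.memLp_restrict_Ioo 0 T 2).coeFn_toLp] with s h h'
  rw [h, h']

theorem _root_.MeasureTheory.IntegrableOn.intervalIntegrable_of_mem_Icc {E : Type*}
    [NormedAddCommGroup E] {f : ℝ → E} {c d a b : ℝ} (hf : IntegrableOn f (Set.Icc c d))
    (ha : a ∈ Set.Icc c d) (hb : b ∈ Set.Icc c d) : IntervalIntegrable f volume a b :=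
  (hf.mono_set (Set.uIcc_subset_Icc ha hb)).intervalIntegrable

theorem norm_Lp_sq (𝕜 : Type*) {U : Type*} [RCLike 𝕜] [NormedAddCommGroup U]
    [InnerProductSpace 𝕜 U] {μ : Measure ℝ} (f : Lp U 2 μ) : ‖f‖ ^ 2 = ∫ s, ‖f s‖ ^ 2 ∂μ := by
  rw [← norm_toLp_sq 𝕜 (Lp.memLp f), Lp.toLp_coeFn]

section

variable {𝕜 H U : Type*} [RCLike 𝕜]
  [NormedAddCommGroup H] [InnerProductSpace 𝕜 H] [CompleteSpace H]
  [NormedAddCommGroup U] [InnerProductSpace 𝕜 U] [CompleteSpace U]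

theorem IsWeakSolution.inner_sub_eq_integral {S : StronglyContinuousGroup 𝕜 H}
    {B : U →L[𝕜] DualDomain S.generator} {T : ℝ} (hT : 0 < T) {y₀ : H} {u : ℝ → U} {y : ℝ → H}
    (hu : MemLp u 2 (volume.restrict (Set.Ioo 0 T))) (hy : IsWeakSolution S.generator B T y₀ u y)
    (φ : (S.generator†).domain) {a b : ℝ} (ha : a ∈ Set.Icc 0 T) (hb : b ∈ Set.Icc 0 T) :
    inner 𝕜 (y b) (φ : H) - inner 𝕜 (y a) (φ : H) =
      ∫ s in a..b, (inner 𝕜 (y s) (S.generator† φ) + inner 𝕜 (u s) (controlAdjoint B φ)) := by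
  refine sub_eq_integral_of_distributional_deriv_Icc (f := fun s => inner 𝕜 (y s) (φ : H)) hT
    (hy.continuousOn.inner continuousOn_const) ?_ (fun η h1 h2 h3 => ?_) ha hb
  · refine IntegrableOn.mono_set ?_ Set.Ioo_subset_Icc_self
    exact ((hy.continuousOn.inner continuousOn_const).integrableOn_Icc).add
      (integrableOn_inner_of_memLp hu continuous_const)
  · simp only [RCLike.real_smul_eq_coe_mul]
    exact hy.weak φ η h1 h2 h3

theorem adj_sub_eq_integral (S : StronglyContinuousGroup 𝕜 H) [NormedSpace ℝ H]
    [IsScalarTower ℝ 𝕜 H] (T a b : ℝ) (φ : (S.generator†).domain) :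
    S.adj (T - b) φ - S.adj (T - a) φ = -∫ s in a..b, S.adj (T - s) (S.generator† φ) := by
  have hd : ∀ s ∈ Set.uIcc a b, HasDerivAt (fun s => S.adj (T - s) φ)
      (-(S.adj (T - s) (S.generator† φ))) s := by
    intro s _
    have h := HasDerivAt.scomp (h := fun r : ℝ => T - r) s (S.hasDerivAt_adj φ (T - s))
      ((hasDerivAt_id s).const_sub T)
    rw [neg_one_smul] at h
    exact h
  have hc : Continuous fun s => -(S.adj (T - s) (S.generator† φ)) :=
    ((S.continuous_adj_apply _).comp (continuous_const.sub continuous_id)).neg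
  rw [← intervalIntegral.integral_neg,
    intervalIntegral.integral_eq_sub_of_hasDerivAt hd (hc.intervalIntegrable _ _)]

/-- A weak solution is given by the variation of constants formula. -/
theorem IsWeakSolution.inner_eq_integral {S : StronglyContinuousGroup 𝕜 H}
    {B : U →L[𝕜] DualDomain S.generator} {T : ℝ} (hT : 0 < T) {y₀ : H} {u : ℝ → U} {y : ℝ → H}
    (hu : MemLp u 2 (volume.restrict (Set.Ioo 0 T))) (hy : IsWeakSolution S.generator B T y₀ u y)
    (φ : (S.generator†).domain) :
    inner 𝕜 (y T) (φ : H) = inner 𝕜 y₀ (S.adj T φ) +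
      ∫ s in Set.Ioo 0 T, inner 𝕜 (u s) (controlAdjoint B (S.adjDom (T - s) φ)) := by
  let := NormedSpace.restrictScalars ℝ 𝕜 H
  have : IsScalarTower ℝ 𝕜 H := StronglyContinuousGroup.isScalarTower_restrictScalars
  let c : ℝ → U := fun s => controlAdjoint B (S.adjDom (T - s) φ)
  have hc : Continuous c := continuous_controlAdjoint_sub S B T φ
  let p : ℝ → H := fun s => S.adj (T - s) (S.generator† φ)
  have hp : Continuous p := (S.continuous_adj_apply _).comp (continuous_const.sub continuous_id)
  have hyc := hy.continuousOn
  have huc := integrableOn_inner_of_memLp (𝕜 := 𝕜) hu hc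
  have hun : IntegrableOn (fun s => ‖u s‖) (Set.Icc 0 T) := by
    rw [integrableOn_Icc_iff_integrableOn_Ioo]
    exact (hu.integrable one_le_two).norm
  obtain ⟨M₁, hM₁⟩ := (isCompact_Icc.image_of_continuousOn hyc).isBounded.exists_norm_le
  obtain ⟨M₂, hM₂⟩ := ((isCompact_Icc (a := 0) (b := T)).image hp).isBounded.exists_norm_le
  -- The summands weight the oscillations of `y`, `p` and `c` respectively in the increment
  -- estimate.
  let v : ℝ → ℝ := fun s => M₂ + M₁ + ‖u s‖
  have hv : IntegrableOn v (Set.Icc 0 T) := continuousOn_const.integrableOn_Icc.add hun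
  -- `D` should be constant, but `u` is only `L²`, so increments are estimated instead of
  -- differentiating.
  let D : ℝ → 𝕜 := fun t => inner 𝕜 (y t) (S.adj (T - t) φ) - ∫ s in (0 : ℝ)..t, inner 𝕜 (u s) (c s)
  have h0 : (0 : ℝ) ∈ Set.Icc 0 T := ⟨le_rfl, hT.le⟩
  have hD : D T = D 0 := by
    refine eq_of_norm_sub_le_mul_of_dist_lt (V := fun t => ∫ s in (0 : ℝ)..t, v s) hT
      fun ε hε => ?_
    have hunif := isCompact_Icc.uniformContinuousOn_of_continuous
      (hyc.prodMk (hp.prodMk hc).continuousOn)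
    obtain ⟨δ, hδ, hδ'⟩ := Metric.uniformContinuousOn_iff.1 hunif ε hε
    refine ⟨δ, hδ, fun a b ha hab hb hba => ?_⟩
    have haI : a ∈ Set.Icc 0 T := ⟨ha, hab.trans hb⟩
    have hbI : b ∈ Set.Icc 0 T := ⟨ha.trans hab, hb⟩
    have hsub : Set.Icc a b ⊆ Set.Icc 0 T := Set.Icc_subset_Icc ha hb
    have e1 : inner 𝕜 (y b) (S.adj (T - b) φ) - inner 𝕜 (y b) (S.adj (T - a) φ) =
        -∫ s in a..b, inner 𝕜 (y b) (p s) := by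
      rw [← inner_sub_right, adj_sub_eq_integral, inner_neg_right]
      have h1 := (innerSL 𝕜 (y b)).intervalIntegral_comp_comm
        (hp.intervalIntegrable a b : IntervalIntegrable _ volume a b)
      rw [innerSL_apply_apply] at h1
      rw [← h1]
      rfl
    have e2 := hy.inner_sub_eq_integral hT hu (S.adjDom (T - a) φ) haI hbI
    rw [S.adjoint_adjDom] at e2
    have e3 := intervalIntegral.integral_add_adjacent_intervals
      (huc.intervalIntegrable_of_mem_Icc h0 haI) (huc.intervalIntegrable_of_mem_Icc haI hbI)
    have i1 : IntervalIntegrable (fun s => inner 𝕜 (y s) (p a) + inner 𝕜 (u s) (c a)) volume a b :=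
      ((((hyc.inner continuousOn_const).integrableOn_Icc).add
        (integrableOn_inner_of_memLp hu continuous_const)).intervalIntegrable_of_mem_Icc haI hbI)
    have i2 : IntervalIntegrable (fun s => inner 𝕜 (y b) (p s)) volume a b :=
      (continuous_const.inner hp).intervalIntegrable _ _
    have i3 := huc.intervalIntegrable_of_mem_Icc haI hbI
    -- The increment is split by freezing the adjoint state at `a` in the weak formulation and `y`
    -- at `b` in the adjoint equation. The integrand then consists of oscillations over `[a, b]`,
    -- small by uniform continuity.
    have e4 : D b - D a = ∫ s in a..b, (inner 𝕜 (y s) (p a) + inner 𝕜 (u s) (c a)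
        - inner 𝕜 (y b) (p s) - inner 𝕜 (u s) (c s)) := by
      rw [intervalIntegral.integral_sub (i1.sub i2) i3, intervalIntegral.integral_sub i1 i2]
      have e2' : inner 𝕜 (y b) (S.adj (T - a) φ) - inner 𝕜 (y a) (S.adj (T - a) φ) =
        ∫ s in a..b, (inner 𝕜 (y s) (p a) + inner 𝕜 (u s) (c a)) := e2
      simp only [D]
      rw [← e2', ← e3]
      linear_combination e1
    have e5 := intervalIntegral.integral_interval_sub_left
      (hv.intervalIntegrable_of_mem_Icc h0 hbI) (hv.intervalIntegrable_of_mem_Icc h0 haI)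
    rw [e4, e5, ← intervalIntegral.integral_const_mul]
    refine intervalIntegral.norm_integral_le_of_norm_le hab
      (Eventually.of_forall fun s hs => ?_)
      ((hv.intervalIntegrable_of_mem_Icc haI hbI).const_mul ε)
    have hsI : s ∈ Set.Icc 0 T := hsub ⟨hs.1.le, hs.2⟩
    have d1 := hδ' s hsI b hbI (by
      rw [Real.dist_eq, abs_sub_comm, abs_of_nonneg (by linarith [hs.2])]; linarith [hs.1])
    have d2 := hδ' a haI s hsI (by
      rw [Real.dist_eq, abs_sub_comm, abs_of_nonneg (by linarith [hs.1])]; linarith [hs.2])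
    rw [Prod.dist_eq, max_lt_iff, Prod.dist_eq, max_lt_iff] at d1 d2
    simp only [dist_eq_norm] at d1 d2
    have e6 : inner 𝕜 (y s) (p a) + inner 𝕜 (u s) (c a) - inner 𝕜 (y b) (p s)
        - inner 𝕜 (u s) (c s) = inner 𝕜 (y s - y b) (p a) + inner 𝕜 (y b) (p a - p s)
          + inner 𝕜 (u s) (c a - c s) := by
      simp only [inner_sub_left, inner_sub_right]; ring
    rw [e6]
    calc _ ≤ ‖y s - y b‖ * ‖p a‖ + ‖y b‖ * ‖p a - p s‖ + ‖u s‖ * ‖c a - c s‖ :=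
          norm_add₃_le.trans (add_le_add (add_le_add (norm_inner_le_norm _ _)
            (norm_inner_le_norm _ _)) (norm_inner_le_norm _ _))
      _ ≤ ε * M₂ + M₁ * ε + ‖u s‖ * ε := by
          have hb1 := hM₁ _ ⟨b, hbI, rfl⟩
          have hp1 := hM₂ _ ⟨a, haI, rfl⟩
          exact add_le_add (add_le_add
            (mul_le_mul d1.1.le hp1 (norm_nonneg _) hε.le)
            (mul_le_mul hb1 d2.2.1.le (norm_nonneg _) ((norm_nonneg _).trans hb1)))
            (mul_le_mul_of_nonneg_left d2.2.2.le (norm_nonneg _))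
      _ = ε * v s := by simp only [v]; ring
  simp only [D, sub_self, sub_zero, S.adj_zero_apply, intervalIntegral.integral_same,
    hy.initial] at hD
  rw [sub_eq_iff_eq_add, intervalIntegral.integral_of_le hT.le,
    integral_Ioc_eq_integral_Ioo] at hD
  exact hD

/-- Exact controllability implies the observability inequality for the adjoint system. -/
theorem ExactlyControllable.exists_norm_le {S : StronglyContinuousGroup 𝕜 H}
    {B : U →L[𝕜] DualDomain S.generator} {T : ℝ} (hT : 0 < T)
    (h : ExactlyControllable S.generator B T) :
    ∃ C : ℝ, 0 ≤ C ∧ ∀ φ : (S.generator†).domain, ‖(φ : H)‖ ^ 2 ≤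
      C * ∫ s in Set.Ioo 0 T, ‖controlAdjoint B (S.adjDom (-s) φ)‖ ^ 2 := by
  have hg : ∀ φ, MemLp (fun s => controlAdjoint B (S.adjDom (T - s) φ)) 2
      (volume.restrict (Set.Ioo 0 T)) :=
    fun φ => (continuous_controlAdjoint_sub S B T φ).memLp_restrict_Ioo _ _ _
  -- The roles are reversed compared with admissibility: the vectors are the `φ`, the weights are
  -- the `L²` norms, and the test vector `y₁` is reached from `0` by some control.
  obtain ⟨C, hC0, hC⟩ := exists_norm_le_mul_of_forall_inner (𝕜 := 𝕜)
    (fun φ : (S.generator†).domain => (φ : H)) (fun φ => ‖(hg φ).toLp _‖)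
    (fun _ => norm_nonneg _) (by
      intro y₁
      obtain ⟨u, hu, y, hy, hy₁⟩ := h 0 y₁
      refine ⟨‖hu.toLp u‖, fun φ => ?_⟩
      have h1 := hy.inner_eq_integral hT hu φ
      rw [inner_zero_left, zero_add, ← inner_toLp hu (hg φ), hy₁] at h1
      rw [norm_inner_symm, h1]
      exact norm_inner_le_norm _ _)
  refine ⟨(‖S.adj T‖ * C) ^ 2, by positivity, fun φ => ?_⟩
  have h1 : ‖(φ : H)‖ ≤ ‖S.adj T‖ * ‖((S.adjDom (-T) φ : (S.generator†).domain) : H)‖ := by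
    have h2 : (φ : H) = S.adj T (S.adjDom (-T) φ : (S.generator†).domain) := by
      change (φ : H) = S.adj T (S.adj (-T) φ)
      rw [← S.adj_add_apply, add_neg_cancel, S.adj_zero_apply]
    conv_lhs => rw [h2]
    exact (S.adj T).le_opNorm _
  have h3 := h1.trans (mul_le_mul_of_nonneg_left (hC (S.adjDom (-T) φ)) (norm_nonneg _))
  have h4 := pow_le_pow_left₀ (norm_nonneg _) h3 2
  rw [← mul_assoc, mul_pow, norm_toLp_sq 𝕜] at h4
  simpa only [← adjDom_neg_eq] using h4

/-- On `(0, T)` the weight is bounded below, so observability passes to `Ψ` on `𝓓(A^*)` and, by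
density, to `H`. -/
theorem ExactlyControllable.exists_norm_le_extension {S : StronglyContinuousGroup 𝕜 H}
    {B : U →L[𝕜] DualDomain S.generator} {T : ℝ} (hT : 0 < T)
    (h : ExactlyControllable S.generator B T) {lam : ℝ}
    {Ψ : H →L[𝕜] Lp U 2 (volume.restrict (Set.Ioi (0 : ℝ)))}
    (hΨ : ∀ φ : (S.generator†).domain,
      Ψ φ =ᵐ[volume.restrict (Set.Ioi (0 : ℝ))] weightedOutput S B lam φ) :
    ∃ C : ℝ, 0 < C ∧ ∀ z : H, ‖z‖ ^ 2 ≤ C * ‖Ψ z‖ ^ 2 := by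
  obtain ⟨C, hC0, hC⟩ := h.exists_norm_le hT
  -- The `+ 1` makes the constant strictly positive, since it is later divided by.
  have hdom : ∀ φ : (S.generator†).domain,
      ‖(φ : H)‖ ^ 2 ≤ (C * Real.exp (|lam| * T) ^ 2 + 1) * ‖Ψ φ‖ ^ 2 := by
    intro φ
    have hΨφ : ‖Ψ φ‖ ^ 2 = ∫ s in Set.Ioi (0 : ℝ), ‖weightedOutput S B lam φ s‖ ^ 2 := by
      rw [norm_Lp_sq 𝕜]
      refine integral_congr_ae ?_
      filter_upwards [hΨ φ] with s hs
      rw [hs]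
    have hint : IntegrableOn (fun s => ‖weightedOutput S B lam φ s‖ ^ 2) (Set.Ioi 0) :=
      (memLp_two_iff_integrable_sq_norm
        (continuous_weightedOutput S B lam φ).aestronglyMeasurable).1
        ((Lp.memLp (Ψ φ)).ae_eq (hΨ φ))
    have h1 : ∫ s in Set.Ioo 0 T, ‖controlAdjoint B (S.adjDom (-s) φ)‖ ^ 2 ≤
        Real.exp (|lam| * T) ^ 2 * ‖Ψ φ‖ ^ 2 := by
      rw [hΨφ]
      calc _ ≤ ∫ s in Set.Ioo 0 T,
            Real.exp (|lam| * T) ^ 2 * ‖weightedOutput S B lam φ s‖ ^ 2 := by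
            refine setIntegral_mono_on ?_
              ((hint.mono_set Set.Ioo_subset_Ioi_self).const_mul _) measurableSet_Ioo fun s hs => ?_
            · exact (((continuous_controlAdjoint_neg S B φ).norm.pow 2).integrableOn_Icc).mono_set
                Set.Ioo_subset_Icc_self
            · rw [norm_weightedOutput, ← mul_pow, ← mul_assoc]
              refine pow_le_pow_left₀ (norm_nonneg _) (le_mul_of_one_le_left (norm_nonneg _) ?_) 2
              have h2 := exp_mul_le_exp_abs_mul (lam := lam) hs.1.le hs.2.le
              rw [neg_mul, Real.exp_neg, ← div_eq_mul_inv, one_le_div (Real.exp_pos _)]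
              exact h2
        _ = Real.exp (|lam| * T) ^ 2 * ∫ s in Set.Ioo 0 T, ‖weightedOutput S B lam φ s‖ ^ 2 :=
            integral_const_mul _ _
        _ ≤ _ := mul_le_mul_of_nonneg_left (setIntegral_mono_set hint
            (Eventually.of_forall fun s => by positivity)
            (Set.Ioo_subset_Ioi_self.eventuallyLE)) (by positivity)
    calc _ ≤ _ := hC φ
      _ ≤ C * (Real.exp (|lam| * T) ^ 2 * ‖Ψ φ‖ ^ 2) := mul_le_mul_of_nonneg_left h1 hC0
      _ ≤ _ := by nlinarith [sq_nonneg ‖Ψ φ‖]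
  refine ⟨C * Real.exp (|lam| * T) ^ 2 + 1, by positivity, fun z => ?_⟩
  exact S.dense_adjoint_domain.induction (P := fun z => ‖z‖ ^ 2 ≤
    (C * Real.exp (|lam| * T) ^ 2 + 1) * ‖Ψ z‖ ^ 2) (fun z hz => hdom ⟨z, hz⟩)
    (isClosed_le (by fun_prop) (by fun_prop)) z

/-- Coercivity passes from `W` to the Gramian: `re ⟨Q z, z⟩ ≥ c ‖Ψ z‖² ≥ (c / C) ‖z‖²`. -/
theorem isUnit_gramian {Ψ : H →L[𝕜] Lp U 2 (volume.restrict (Set.Ioi (0 : ℝ)))} {C : ℝ}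
    (hC : 0 < C) (hΨ : ∀ z : H, ‖z‖ ^ 2 ≤ C * ‖Ψ z‖ ^ 2) {W : U →L[𝕜] U} (hW : IsCoercive W) :
    IsUnit (gramian Ψ W) := by
  obtain ⟨c, hc, hcW⟩ := hW
  refine ContinuousLinearMap.isUnit_of_forall_le_norm_inner_map _ (c := ⟨c / C, by positivity⟩)
    (show (0 : ℝ) < c / C by positivity) fun z => ?_
  change ‖z‖ ^ 2 * (c / C) ≤ _
  calc ‖z‖ ^ 2 * (c / C) ≤ C * ‖Ψ z‖ ^ 2 * (c / C) :=
        mul_le_mul_of_nonneg_right (hΨ z) (by positivity)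
    _ = ∫ s in Set.Ioi (0 : ℝ), c * ‖Ψ z s‖ ^ 2 := by
        rw [integral_const_mul, ← norm_Lp_sq 𝕜]
        field_simp
    _ ≤ ∫ s in Set.Ioi (0 : ℝ), RCLike.re (inner 𝕜 (W (Ψ z s)) (Ψ z s)) :=
        integral_mono (((memLp_two_iff_integrable_sq_norm (Lp.memLp (Ψ z)).1).1
          (Lp.memLp (Ψ z))).const_mul c) (integrable_inner_extension Ψ W z z).re
          fun s => hcW _
    _ = RCLike.re (inner 𝕜 (gramian Ψ W z) z) := by
        rw [inner_gramian]
        exact integral_re (integrable_inner_extension Ψ W z z)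
    _ ≤ _ := RCLike.re_le_norm _

end

end ControlGramian

end

theorem mainTheorem7 {𝕜 H U : Type*} [RCLike 𝕜]
    [NormedAddCommGroup H] [InnerProductSpace 𝕜 H] [CompleteSpace H]
    [NormedAddCommGroup U] [InnerProductSpace 𝕜 U] [CompleteSpace U]
    (S : ControlGramian.StronglyContinuousGroup 𝕜 H)
    (B : U →L[𝕜] ControlGramian.DualDomain S.generator)
    (hB : ControlGramian.IsAdmissible S B)
    (T : ℝ) (hT : 0 < T)
    (hctrl : ControlGramian.ExactlyControllable S.generator B T)
    (lam : ℝ)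
    (W : U →L[𝕜] U)
    (hW_symm : ∀ u v : U, inner 𝕜 (W u) v = inner 𝕜 u (W v))
    (hW_nonneg : ∀ u : U, 0 ≤ RCLike.re (inner 𝕜 (W u) u))
    (hlam : ControlGramian.growthBound (fun s : ℝ => S.adj (-s)) < (lam : EReal)) :
    (∀ z : H, ∃ w : ℝ → U, ControlGramian.IsOutput S B z w) ∧
    ∃ Q : H →L[𝕜] H,
      (∀ Q' : H → H, ControlGramian.IsGramian S B W lam Q' ↔ Q' = Q) ∧
      (∀ z₁ z₂ : H, inner 𝕜 (Q z₁) z₂ = inner 𝕜 z₁ (Q z₂)) ∧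
      (ControlGramian.IsCoercive W → IsUnit Q) ∧
      ControlGramian.OperatorIdentity S.generator B Q 0 W lam := by
  obtain ⟨Ψ, hΨ⟩ := hB.exists_extension hlam
  have hout : ∀ z : H, ∃ w : ℝ → U, ControlGramian.IsOutput S B z w :=
    fun z => ⟨_, ControlGramian.isOutput_of_extension hΨ z⟩
  obtain ⟨C, hC, hobs⟩ := hctrl.exists_norm_le_extension hT hΨ
  exact ⟨hout, ControlGramian.gramian Ψ W,
    ControlGramian.isGramian_iff hout (ControlGramian.isGramian_gramian hΨ W),
    ControlGramian.inner_gramian_symm Ψ hW_symm,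
    ControlGramian.isUnit_gramian hC hobs,
    ControlGramian.operatorIdentity_gramian hΨ hW_symm⟩
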